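/- Let $X\in\mathbb R^{N\times d}$ be a data matrix (of weighted examples) with columns $x^{(1)},\dots,x^{(d)}\in\mathbb R^N$, where $d\ge 1$, put $\eta_2=\max_{l\in[d]}\|x^{(l)}\|$, and let $\mathcal C_1,\dots,\mathcal C_k\subseteq[N]$, $k\ge 1$, be nonempty clusters with centroids $c_j=\frac1{|\mathcal C_j|}\sum_{i\in\mathcal C_j}(x_{i1},\dots,x_{id})\in\mathbb R^d$. Suppose that we have (controlled, coherent) access to unitaries $U_\xi$ and $U_x$ and their inverses with $$U_\xi:\ |j\rangle|0\rangle\mapsto|j\rangle|\xi_j\rangle,\quad |\xi_j\rangle=\frac1{\sqrt{|\mathcal C_j|}}\sum_{i\in\mathcal C_j}|i\rangle\quad(j\in[k]),\qquad U_x:\ |l\rangle|0\rangle\mapsto|l\rangle|x^{(l)}\rangle,\quad |x^{(l)}\rangle=\frac1{\|x^{(l)}\|}\sum_{i=1}^N x_{il}|i\rangle\quad(l\in[d],\ x^{(l)}\ne0),$$ where a use of $U_\xi$ or its inverse takes time $T_\xi$, a use of $U_x$ or its inverse takes time $T$, and $T=O(T_\xi)$. The norms $\|x^{(l)}\|$ and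 the cluster sizes $|\mathcal C_j|$ are known. The running time of an algorithm is the total time of its uses of $U_\xi$, $U_x$ and their inverses; operations that do not depend on the data are not charged. Then for every $\varepsilon_2>0$ and every constant success probability $p<1$ there is a quantum algorithm, depending on $X$ and the clusters only through the norms $\|x^{(l)}\|$, the sizes $|\mathcal C_j|$ and its access to $U_\xi$ and $U_x$, that outputs vectors $\overline{c_1},\dots,\overline{c_k}\in\mathbb R^d$ such that, with probability at least $p$, $$\|\overline{c_j}-c_j\|_\infty\le\varepsilon_2\quad\text{for all } j\in[k]\text{ simultaneously},$$ in time $$O\!\left(\frac{T_\xi\,k\,d\,\eta_2}{\varepsilon_2}\right),$$ where the implied constant depends only on $p$ and on the constant in $T=O(T_\xi)$. -/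

import Mathlib

/-- Euclidean norm of the `l`-th column (feature vector) of the data matrix. -/
noncomputable def colNorm {N d : ℕ} (X : Matrix (Fin N) (Fin d) ℝ) (l : Fin d) : ℝ :=
  Real.sqrt (∑ i, X i l ^ 2)

/-- The centroid of the cluster `S`: the mean of the rows of `X` with index in `S`. -/
noncomputable def centroid {N d : ℕ} (X : Matrix (Fin N) (Fin d) ℝ) (S : Finset (Fin N)) :
    Fin d → ℝ :=
  fun l => (∑ i ∈ S, X i l) / (S.card : ℝ)

/-- Amplitude encoding of the `l`-th column in an `n`-qubit register, `N ≤ 2 ^ n`. -/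
noncomputable def featureState {N d : ℕ} (n : ℕ) (X : Matrix (Fin N) (Fin d) ℝ) (l : Fin d) :
    Fin (2 ^ n) → ℂ :=
  fun y => if h : (y : ℕ) < N then ((X ⟨y, h⟩ l / colNorm X l : ℝ) : ℂ) else 0

/-- Characteristic state of the cluster `S` in an `n`-qubit register, `N ≤ 2 ^ n`: the uniform
superposition of the indices in `S`. -/
noncomputable def characteristicState {N : ℕ} (n : ℕ) (S : Finset (Fin N)) : Fin (2 ^ n) → ℂ :=
  fun y => if h : (y : ℕ) < N then
    (if (⟨y, h⟩ : Fin N) ∈ S then ((1 / Real.sqrt (S.card : ℝ) : ℝ) : ℂ) else 0) else 0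

/-- The unitary `O` on an index register and an `n`-qubit register performs
`|i⟩|0⟩ ↦ |i⟩|state i⟩` for the index `i`. -/
def PreparesAt {ι : Type} [Fintype ι] [DecidableEq ι] {n : ℕ}
    (O : Matrix.unitaryGroup (ι × Fin (2 ^ n)) ℂ) (i : ι) (state : Fin (2 ^ n) → ℂ) : Prop :=
  ∀ (i' : ι) (y : Fin (2 ^ n)),
    (O : Matrix (ι × Fin (2 ^ n)) (ι × Fin (2 ^ n)) ℂ) (i', y) (i, 0)
      = if i' = i then state y else 0

/-- Computational basis states: a control qubit, a feature index, a cluster index, an `n`-qubit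
data register and `a` ancilla qubits. -/
abbrev BasisState (d k n a : ℕ) : Type :=
  Bool × Fin d × Fin k × Fin (2 ^ n) × Fin (2 ^ a)

/-- One step of a quantum algorithm: a fixed unitary (independent of the data), or one controlled
use of the preparation unitary for the feature states, or of the one for the characteristic
states; the inverse of the preparation unitary is used if `inv = true`. -/
inductive QStep (d k n a : ℕ) : Type where
  | gate (V : Matrix.unitaryGroup (BasisState d k n a) ℂ) : QStep d k n a
  | feature (inv : Bool) : QStep d k n a
  | characteristic (inv : Bool) : QStep d k n a

/-- The action of a step on a state vector. The feature preparation acts on the feature index and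
the data register, the characteristic preparation on the cluster index and the data register, in
both cases if the control qubit is `1`. -/
noncomputable def QStep.apply {d k n a : ℕ}
    (Ox : Matrix.unitaryGroup (Fin d × Fin (2 ^ n)) ℂ)
    (Oxi : Matrix.unitaryGroup (Fin k × Fin (2 ^ n)) ℂ) :
    QStep d k n a → (BasisState d k n a → ℂ) → (BasisState d k n a → ℂ)
  | .gate V, ψ => (V : Matrix (BasisState d k n a) (BasisState d k n a) ℂ).mulVec ψ
  | .feature inv, ψ => fun (c, l, j, y, w) =>
      if c = true then
        ∑ q : Fin d × Fin (2 ^ n),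
          ((if inv = true then Ox⁻¹ else Ox :
            Matrix.unitaryGroup (Fin d × Fin (2 ^ n)) ℂ) : Matrix _ _ ℂ) (l, y) q
            * ψ (c, q.1, j, q.2, w)
      else ψ (c, l, j, y, w)
  | .characteristic inv, ψ => fun (c, l, j, y, w) =>
      if c = true then
        ∑ q : Fin k × Fin (2 ^ n),
          ((if inv = true then Oxi⁻¹ else Oxi :
            Matrix.unitaryGroup (Fin k × Fin (2 ^ n)) ℂ) : Matrix _ _ ℂ) (j, y) q
            * ψ (c, l, q.1, q.2, w)
      else ψ (c, l, j, y, w)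

/-- Running time of a step: `T` for a use of the feature preparation, `Txi` for a use of the
characteristic-state preparation. As in the running time `O(T(U)/ε)` of amplitude estimation,
operations that do not touch the data are not charged. -/
def QStep.time {d k n a : ℕ} (T Txi : ℝ) : QStep d k n a → ℝ
  | .gate _ => 0
  | .feature _ => T
  | .characteristic _ => Txi

/-- A quantum algorithm that outputs `k` vectors of length `d`: a finite list of steps, applied in
order to the all-zero state, followed by a measurement in the computational basis, whose outcome is
decoded into the output vectors. -/
structure CentroidAlgorithm (d k n a : ℕ) : Type where
  steps : List (QStep d k n a)
  output : BasisState d k n a → Fin k → Fin d → ℝ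

namespace CentroidAlgorithm

variable {d k n a : ℕ}

/-- Total running time. -/
def time (A : CentroidAlgorithm d k n a) (T Txi : ℝ) : ℝ :=
  (A.steps.map (QStep.time T Txi)).sum

/-- The state before the measurement. -/
noncomputable def finalState [NeZero d] [NeZero k] (A : CentroidAlgorithm d k n a)
    (Ox : Matrix.unitaryGroup (Fin d × Fin (2 ^ n)) ℂ)
    (Oxi : Matrix.unitaryGroup (Fin k × Fin (2 ^ n)) ℂ) : BasisState d k n a → ℂ :=
  A.steps.foldl (fun ψ s => s.apply Ox Oxi ψ) (Pi.single (false, 0, 0, 0, 0) 1)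

open scoped Classical in
/-- Probability that the output vectors satisfy `P`. -/
noncomputable def outputProb [NeZero d] [NeZero k] (A : CentroidAlgorithm d k n a)
    (Ox : Matrix.unitaryGroup (Fin d × Fin (2 ^ n)) ℂ)
    (Oxi : Matrix.unitaryGroup (Fin k × Fin (2 ^ n)) ℂ)
    (P : (Fin k → Fin d → ℝ) → Prop) : ℝ :=
  ∑ b, if P (A.output b) then ‖A.finalState Ox Oxi b‖ ^ 2 else 0

end CentroidAlgorithm

/-! A centroid coordinate is a rescaled real inner product: $c_{jl} =
(\|x^{(l)}\|/\sqrt{|C_j|})\,\langle\xi_j, x^{(l)}\rangle$. So it suffices to estimate at most $kd$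
inner products $r$ to precision $1/n_0$, $n_0 = \lceil\eta_2/\varepsilon_2\rceil$, all at once.
Boosting separate estimates would cost a factor $\log(kd)$. It is avoided by bounding only the total
number of rotations, not the number for each pair.

For one pair let $\varphi = (|0\rangle|x\rangle + |1\rangle|\xi\rangle)/\sqrt2$ and let $X$ flip the
control qubit. Then $\langle\varphi, X\varphi\rangle = r$, and the reflection about $\varphi$
followed by $X$ is a rotation by $\theta = \arccos r$ (`exists_rotation_of_reflections`,
`exists_walk`), at two uses of each oracle. Phase estimation with an amplitude profile $g$ on the
number $z$ of rotations then reveals $\cos\theta = r$, sign included. The profile consists of the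
Fourier coefficients of a hat function of half-width $1/n_0$ (`exists_window`). The full series
vanishes off the hat, so a late truncation makes the failure probability as small as desired, while
the mean of $|z|$ stays $O(n_0)$ wherever the series is cut. Failure $\kappa/(kd)$ per pair
therefore does not raise the bound on the mean cost.

All pairs are treated in superposition and share a budget of $L = O(kd\,n_0)$ rotations. By Markov's
inequality the branches with $\sum|z_i| > L$ have small weight, and dropping them hardly changes the
outcome (`one_sub_le_sum_good_budget`). A schedule controlled by the counters selects the pair to
rotate in each round (`exists_schedule`), so only $L$ rounds are charged
(`exists_inner_product_estimation`). -/

/-! ### Fourier series of a hat function -/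

-- This is the Fourier expansion of the second Bernoulli polynomial; the term $z = 0$ is zero
-- because `1 / 0 = 0`.
open Complex in
theorem hasSum_inv_sq_mul_exp {t : ℝ} (h0 : 0 ≤ t) (h1 : t ≤ 2 * Real.pi) :
    HasSum (fun z : ℤ => 1 / (z : ℂ) ^ 2 * exp (z * t * I))
      ((Real.pi ^ 2 / 3 - Real.pi * t + t ^ 2 / 2 : ℝ) : ℂ) := by
  have hpi := Real.pi_pos
  have h := hasSum_one_div_pow_mul_fourier_mul_bernoulliFun (k := 2) le_rfl
    (x := t / (2 * Real.pi)) ⟨by positivity, by rw [div_le_one (by positivity)]; exact h1⟩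
  convert h using 1
  · funext z
    rw [fourier_coe_apply]
    congr 2
    have : (Real.pi : ℂ) ≠ 0 := by exact_mod_cast hpi.ne'
    push_cast
    field_simp
  · have : (Real.pi : ℂ) ≠ 0 := by exact_mod_cast hpi.ne'
    rw [bernoulliFun_two]
    push_cast
    field_simp
    rw [I_sq]
    simp [Nat.factorial]
    ring

/-- Fourier coefficients (up to a constant) of a hat function of half-width `δ`. -/
noncomputable def hatCoeff (δ : ℝ) (z : ℤ) : ℝ :=
  if z = 0 then δ ^ 2 / 2 else (1 - Real.cos (z * δ)) / (z : ℝ) ^ 2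

theorem hatCoeff_nonneg (δ : ℝ) (z : ℤ) : 0 ≤ hatCoeff δ z := by
  unfold hatCoeff
  split_ifs
  · positivity
  · exact div_nonneg (by linarith [Real.cos_le_one (z * δ)]) (by positivity)

-- The factor $1 - \cos(z\delta)$ turns $e^{izx}$ into the second difference $e^{izx} - \frac12
-- e^{iz(x+\delta)} - \frac12 e^{iz(x-\delta)}$. The coefficient at $z = 0$ has to be added by hand.
open Complex in
theorem hasSum_hatCoeff_aux {δ x a b c : ℝ}
    (ha : HasSum (fun z : ℤ => 1 / (z : ℂ) ^ 2 * exp (z * x * I)) (a : ℂ))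
    (hb : HasSum (fun z : ℤ => 1 / (z : ℂ) ^ 2 * exp (z * (x + δ : ℝ) * I)) (b : ℂ))
    (hc : HasSum (fun z : ℤ => 1 / (z : ℂ) ^ 2 * exp (z * (x - δ : ℝ) * I)) (c : ℂ)) :
    HasSum (fun z : ℤ => (hatCoeff δ z : ℂ) * exp (z * x * I))
      ((δ ^ 2 / 2 + (a - b / 2 - c / 2) : ℝ) : ℂ) := by
  have h0 : HasSum (fun z : ℤ => if z = 0 then ((δ ^ 2 / 2 : ℝ) : ℂ) else 0)
      ((δ ^ 2 / 2 : ℝ) : ℂ) := hasSum_ite_eq 0 _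
  have h := h0.add ((ha.sub (hb.div_const 2)).sub (hc.div_const 2))
  convert h using 1
  · funext z
    by_cases hz : z = 0
    · subst hz
      simp [hatCoeff]
    · have e1 : exp (z * (x + δ : ℝ) * I) = exp (z * x * I) * exp (z * δ * I) := by
        rw [← exp_add]; congr 1; push_cast; ring
      have e2 : exp (z * (x - δ : ℝ) * I) = exp (z * x * I) * exp (-(z * δ) * I) := by
        rw [← exp_add]; congr 1; push_cast; ring
      have hzc : (z : ℂ) ≠ 0 := by exact_mod_cast hz
      rw [e1, e2]
      simp only [hatCoeff, hz, if_false]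
      push_cast
      rw [Complex.cos]
      field_simp
      ring
  · push_cast
    ring

-- All three points $x, x\pm\delta$ lie in $[0, 2\pi]$, where the sum is one quadratic polynomial;
-- its second difference $-\delta^2/2$ cancels the coefficient at $z = 0$.
open Complex in
theorem hasSum_hatCoeff_mul_exp_eq_zero {δ x : ℝ} (hδ : 0 ≤ δ) (h0 : δ ≤ x)
    (h1 : x ≤ 2 * Real.pi - δ) :
    HasSum (fun z : ℤ => (hatCoeff δ z : ℂ) * exp (z * x * I)) 0 := by
  convert hasSum_hatCoeff_aux (hasSum_inv_sq_mul_exp (by linarith) (by linarith))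
    (hasSum_inv_sq_mul_exp (t := x + δ) (by linarith) (by linarith))
    (hasSum_inv_sq_mul_exp (t := x - δ) (by linarith) (by linarith)) using 1
  norm_cast
  ring

-- The peak of the hat, at $x = 0$. The point $-\delta$ leaves $[0, 2\pi]$, so its series is
-- obtained from that at $\delta$ by $z \mapsto -z$.
open Complex in
theorem hasSum_hatCoeff {δ : ℝ} (hδ : 0 ≤ δ) (h1 : δ ≤ 2 * Real.pi) :
    HasSum (hatCoeff δ) (Real.pi * δ) := by
  have hb := hasSum_inv_sq_mul_exp hδ h1
  have hc : HasSum (fun z : ℤ => 1 / (z : ℂ) ^ 2 * exp (z * (0 - δ : ℝ) * I))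
      ((Real.pi ^ 2 / 3 - Real.pi * δ + δ ^ 2 / 2 : ℝ) : ℂ) := by
    rw [← (Equiv.neg ℤ).hasSum_iff]
    convert hb using 2 with z
    simp
  have h := hasSum_hatCoeff_aux (x := 0)
    (hasSum_inv_sq_mul_exp le_rfl (by positivity)) (by rwa [zero_add]) hc
  rw [← Complex.hasSum_ofReal]
  convert h using 1
  · simp
  · norm_cast
    ring

open Complex in
theorem hasSum_hatCoeff_mul_exp_eq_zero' {δ x : ℝ} (hδ : 0 ≤ δ)
    (h : ∀ k : ℤ, δ ≤ |x - 2 * Real.pi * k|) :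
    HasSum (fun z : ℤ => (hatCoeff δ z : ℂ) * exp (z * x * I)) 0 := by
  have hpi := Real.pi_pos
  -- The hypothesis at the two multiples of $2\pi$ enclosing $x$ places the remainder in $[\delta,
  -- 2\pi - \delta]$.
  set k : ℤ := ⌊x / (2 * Real.pi)⌋ with hk
  have h1 : (k : ℝ) ≤ x / (2 * Real.pi) := Int.floor_le _
  have h2 : x / (2 * Real.pi) < k + 1 := Int.lt_floor_add_one _
  rw [le_div_iff₀ (by positivity)] at h1
  rw [div_lt_iff₀ (by positivity)] at h2
  have h3 := h k
  have h4 := h (k + 1)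
  rw [abs_of_nonneg (by linarith)] at h3
  rw [abs_of_nonpos (by push_cast; linarith)] at h4
  push_cast at h4
  convert hasSum_hatCoeff_mul_exp_eq_zero (x := x - 2 * Real.pi * k) hδ h3 (by linarith) using 3
    with z
  have : (z * (x - 2 * Real.pi * k : ℝ) * I : ℂ)
      = z * x * I - ((z * k : ℤ) : ℂ) * (2 * Real.pi * I) := by push_cast; ring
  rw [this, Complex.exp_periodic.sub_int_mul_eq]

/-! ### The window for phase estimation -/

/-- The integer in `[-2 ^ b, 2 ^ b)` encoded by the basis state `s` of `b + 1` qubits. -/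
def signedValue (b : ℕ) (s : Fin (2 ^ (b + 1))) : ℤ := (s : ℤ) - 2 ^ b

theorem sum_signedValue {M : Type*} [AddCommMonoid M] (b : ℕ) (f : ℤ → M) :
    ∑ s, f (signedValue b s) = ∑ z ∈ Finset.Ico (-2 ^ b : ℤ) (2 ^ b), f z := by
  refine Finset.sum_bij (fun s _ => signedValue b s) ?_ ?_ ?_ ?_
  · intro s _
    have h2 : ((s : ℕ) : ℤ) < 2 ^ b * 2 := by
      rw [← pow_succ]
      exact_mod_cast s.isLt
    simp only [Finset.mem_Ico, signedValue]
    omega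
  · intro s _ t _ hst
    simp only [signedValue] at hst
    ext
    omega
  · intro z hz
    rw [Finset.mem_Ico] at hz
    refine ⟨⟨(z + 2 ^ b).toNat, ?_⟩, Finset.mem_univ _, ?_⟩
    · zify
      rw [Int.toNat_of_nonneg (by omega), pow_succ]
      omega
    · simp only [signedValue]
      rw [Int.toNat_of_nonneg (by omega)]
      ring
  · intros; rfl

theorem exists_subset_Ico_two_pow (s : Finset ℤ) (b₀ : ℕ) :
    ∃ b, b₀ ≤ b ∧ s ⊆ Finset.Ico (-2 ^ b : ℤ) (2 ^ b) := by
  refine ⟨b₀ + ∑ z ∈ s, z.natAbs, by omega, fun z hz => ?_⟩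
  have h1 : z.natAbs ≤ ∑ z ∈ s, z.natAbs :=
    Finset.single_le_sum (f := fun z : ℤ => z.natAbs) (fun _ _ => Nat.zero_le _) hz
  have h2 : b₀ + ∑ z ∈ s, z.natAbs < 2 ^ (b₀ + ∑ z ∈ s, z.natAbs) := Nat.lt_two_pow_self
  have h3 : ((z.natAbs : ℕ) : ℤ) < ((2 ^ (b₀ + ∑ z ∈ s, z.natAbs) : ℕ) : ℤ) := by
    exact_mod_cast lt_of_le_of_lt (by omega) h2
  push_cast at h3
  rw [Finset.mem_Ico]
  have := abs_lt.mp h3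
  exact ⟨this.1.le, this.2⟩

open Complex in
/-- A real amplitude profile on the signed integers of `b + 1` qubits whose Fourier transform is
concentrated (up to `τ`) within `1 / n₀` of the origin, with mean absolute value `O(n₀)`. -/
theorem exists_window (n₀ : ℕ) (hn : 1 ≤ n₀) (τ : ℝ) (hτ : 0 < τ) :
    ∃ (b : ℕ) (g : Fin (2 ^ (b + 1)) → ℝ),
      ∑ s, g s ^ 2 = 1 ∧
      ∑ s, |(signedValue b s : ℝ)| * g s ^ 2 ≤ 80 * n₀ ∧
      ∀ x : ℝ, (∀ k : ℤ, 1 / (n₀ : ℝ) ≤ |x - 2 * Real.pi * k|) →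
        ‖∑ s, (g s : ℂ) * exp (signedValue b s * x * I)‖ ≤ τ := by
  have hn' : (1 : ℝ) ≤ n₀ := by exact_mod_cast hn
  set δ : ℝ := 1 / n₀ with hδdef
  have hδ : 0 < δ := by positivity
  have hδ1 : δ ≤ 1 := by rw [hδdef, div_le_one (by linarith)]; exact hn'
  have hnδ : n₀ * δ = 1 := by rw [hδdef]; field_simp
  have hpi := Real.pi_gt_three
  have hpi' := Real.pi_lt_d2
  have hsum := hasSum_hatCoeff hδ.le (by linarith)
  -- A lower bound for the norm $\sqrt Z$ of the truncated coefficients that does not depend on the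
  -- truncation, since the tail tolerance must be fixed before `b` is.
  set c := Real.sqrt (δ ^ 3 / 25) with hc
  have hcpos : 0 < c := Real.sqrt_pos.mpr (by positivity)
  obtain ⟨s₀, hs₀⟩ := summable_iff_vanishing_norm.mp hsum.summable (τ * c) (by positivity)
  obtain ⟨b, hb, hsub⟩ := exists_subset_Ico_two_pow s₀ n₀
  set S := Finset.Ico (-2 ^ b : ℤ) (2 ^ b) with hS
  -- For $1 \le m \le n_0$ one has $m\delta \le 1$ and $1 - \cos(m\delta) \ge 2(m\delta)^2/\pi^2 \ge
  -- (m\delta)^2/5$. These $n_0 = 1/\delta$ terms, each at least $\delta^4/25$, suffice; `n₀ ≤ b`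
  -- keeps them inside the truncation.
  have hlow : δ ^ 3 / 25 ≤ ∑ z ∈ S, hatCoeff δ z ^ 2 := by
    have hmap : ((Finset.Icc 1 n₀).map Nat.castEmbedding : Finset ℤ) ⊆ S := by
      intro z hz
      simp only [Finset.mem_map, Finset.mem_Icc] at hz
      obtain ⟨m, ⟨hm1, hm2⟩, rfl⟩ := hz
      rw [hS, Finset.mem_Ico]
      have h1 : m < 2 ^ b := lt_of_le_of_lt (hm2.trans hb) Nat.lt_two_pow_self
      have h2 : (m : ℤ) < 2 ^ b := by exact_mod_cast h1
      have h3 : (0 : ℤ) < 2 ^ b := by positivity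
      simp only [Nat.castEmbedding_apply]
      omega
    calc δ ^ 3 / 25 = ∑ m ∈ Finset.Icc 1 n₀, (δ ^ 2 / 5) ^ 2 := by
          simp only [Finset.sum_const, Nat.card_Icc, nsmul_eq_mul, Nat.add_sub_cancel]
          linear_combination (-(δ ^ 3) / 25) * hnδ
      _ ≤ ∑ m ∈ Finset.Icc 1 n₀, hatCoeff δ (m : ℤ) ^ 2 := by
          refine Finset.sum_le_sum fun m hm => ?_
          rw [Finset.mem_Icc] at hm
          have hm1 : (1 : ℝ) ≤ m := by exact_mod_cast hm.1
          have hm2 : (m : ℝ) ≤ n₀ := by exact_mod_cast hm.2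
          refine pow_le_pow_left₀ (by positivity) ?_ 2
          have hmδ : m * δ ≤ 1 := by rw [← hnδ]; gcongr
          have hm0 : (m : ℤ) ≠ 0 := by have := hm.1; omega
          have hq := Real.cos_le_one_sub_mul_cos_sq (x := m * δ)
            (by rw [abs_of_nonneg (by positivity)]; linarith)
          simp only [hatCoeff, hm0, if_false]
          rw [le_div_iff₀ (by positivity)]
          push_cast
          have : (1 : ℝ) / 5 ≤ 2 / Real.pi ^ 2 := by
            rw [div_le_div_iff₀ (by norm_num) (by positivity)]
            nlinarith
          nlinarith [mul_nonneg (sub_nonneg.mpr this) (sq_nonneg (m * δ))]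
      _ = ∑ z ∈ (Finset.Icc 1 n₀).map Nat.castEmbedding, hatCoeff δ z ^ 2 := by
          rw [Finset.sum_map]; rfl
      _ ≤ _ := Finset.sum_le_sum_of_subset_of_nonneg hmap (fun _ _ _ => sq_nonneg _)
  -- One factor of the square is absorbed by $z^2\cdot$`hatCoeff` $\le 2$, and the other is summed
  -- over all integers. The bound is uniform in the truncation.
  have hup : ∑ z ∈ S, (z : ℝ) ^ 2 * hatCoeff δ z ^ 2 ≤ 2 * (Real.pi * δ) := by
    calc _ ≤ ∑ z ∈ S, 2 * hatCoeff δ z := by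
          refine Finset.sum_le_sum fun z _ => ?_
          have hnn := hatCoeff_nonneg δ z
          have : (z : ℝ) ^ 2 * hatCoeff δ z ≤ 2 := by
            unfold hatCoeff
            split_ifs with hz
            · simp [hz]
            · have : (z : ℝ) ≠ 0 := by exact_mod_cast hz
              rw [mul_div_cancel₀ _ (by positivity)]
              linarith [Real.neg_one_le_cos (z * δ)]
          nlinarith
      _ ≤ _ := by
          rw [← Finset.mul_sum]
          gcongr
          exact sum_le_hasSum S (fun z _ => hatCoeff_nonneg δ z) hsum
  set Z := ∑ z ∈ S, hatCoeff δ z ^ 2 with hZ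
  have hZpos : 0 < Z := lt_of_lt_of_le (by positivity) hlow
  have hcZ : c ≤ Real.sqrt Z := Real.sqrt_le_sqrt hlow
  have hsq : Real.sqrt Z ^ 2 = Z := Real.sq_sqrt hZpos.le
  refine ⟨b, fun s => hatCoeff δ (signedValue b s) / Real.sqrt Z, ?_, ?_, ?_⟩
  · simp only [div_pow, hsq]
    rw [sum_signedValue b (fun z => hatCoeff δ z ^ 2 / Z), ← Finset.sum_div, ← hZ,
      div_self hZpos.ne']
  · simp only [div_pow, hsq]
    rw [sum_signedValue b (fun z => |(z : ℝ)| * (hatCoeff δ z ^ 2 / Z))]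
    have key : ∀ z ∈ S, |(z : ℝ)| * (hatCoeff δ z ^ 2 / Z)
        ≤ (n₀ / 2 * hatCoeff δ z ^ 2 + (δ / 2) * ((z : ℝ) ^ 2 * hatCoeff δ z ^ 2)) / Z := by
      intro z _
      rw [← mul_div_assoc]
      gcongr
      -- Expand $\delta(|z| - n_0)^2 \ge 0$ with $n_0\delta = 1$.
      have h1 : |(z : ℝ)| ≤ n₀ / 2 + δ / 2 * (z : ℝ) ^ 2 := by
        rw [← sq_abs (z : ℝ)]
        nlinarith [mul_nonneg hδ.le (sq_nonneg (|(z : ℝ)| - n₀))]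
      nlinarith [mul_le_mul_of_nonneg_right h1 (sq_nonneg (hatCoeff δ z))]
    refine (Finset.sum_le_sum key).trans ?_
    rw [← Finset.sum_div, Finset.sum_add_distrib, ← Finset.mul_sum, ← Finset.mul_sum, ← hZ,
      div_le_iff₀ hZpos]
    have h2 : δ / 2 * ∑ z ∈ S, (z : ℝ) ^ 2 * hatCoeff δ z ^ 2 ≤ Real.pi * δ ^ 2 := by
      nlinarith [mul_le_mul_of_nonneg_left hup (by positivity : 0 ≤ δ / 2)]
    -- The mean is thus at most $(1/2 + 25\pi)n_0$, which explains the constant 80.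
    have h3 : Real.pi * δ ^ 2 ≤ 25 * Real.pi * n₀ * Z := by
      have : δ ^ 2 / 25 ≤ n₀ * Z := by
        calc δ ^ 2 / 25 = n₀ * (δ ^ 3 / 25) := by linear_combination (-(δ ^ 2) / 25) * hnδ
          _ ≤ _ := by gcongr
      nlinarith
    have h4 : 0 < n₀ * Z := by positivity
    nlinarith
  · intro x hx
    have h0 := hasSum_hatCoeff_mul_exp_eq_zero' hδ.le hx
    have hnorm : ∀ z : ℤ, ‖(hatCoeff δ z : ℂ) * exp (z * x * I)‖ = hatCoeff δ z := by
      intro z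
      have : (z * x * I : ℂ) = ((z * x : ℝ) : ℂ) * I := by push_cast; ring
      rw [norm_mul, this, norm_exp_ofReal_mul_I, mul_one, norm_real, Real.norm_eq_abs,
        abs_of_nonneg (hatCoeff_nonneg δ z)]
    -- The full series is zero at `x`, so the truncated sum is minus the tail, and the tail is
    -- bounded by its absolute sum.
    have hlim : ‖(0 : ℂ) - ∑ z ∈ S, (hatCoeff δ z : ℂ) * exp (z * x * I)‖ ≤ τ * c := by
      have ht : Filter.Tendsto (fun t : Finset ℤ => ‖∑ z ∈ t, (hatCoeff δ z : ℂ) * exp (z * x * I)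
          - ∑ z ∈ S, (hatCoeff δ z : ℂ) * exp (z * x * I)‖) Filter.atTop
          (nhds ‖(0 : ℂ) - ∑ z ∈ S, (hatCoeff δ z : ℂ) * exp (z * x * I)‖) :=
        (Filter.Tendsto.sub_const h0 _).norm
      refine le_of_tendsto ht ?_
      filter_upwards [Filter.eventually_ge_atTop S] with t hSt
      rw [← Finset.sum_sdiff (show S ⊆ t from hSt), add_sub_cancel_right]
      refine (norm_sum_le _ _).trans ?_
      simp only [hnorm]
      have := hs₀ (t \ S) (Finset.disjoint_of_subset_right hsub Finset.sdiff_disjoint)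
      exact (le_abs_self _).trans this.le
    rw [zero_sub, norm_neg] at hlim
    have : ∑ s, ((hatCoeff δ (signedValue b s) / Real.sqrt Z : ℝ) : ℂ)
        * exp (signedValue b s * x * I)
        = (∑ z ∈ S, (hatCoeff δ z : ℂ) * exp (z * x * I)) / (Real.sqrt Z : ℂ) := by
      rw [sum_signedValue b (fun z => ((hatCoeff δ z / Real.sqrt Z : ℝ) : ℂ) * exp (z * x * I)),
        Finset.sum_div]
      refine Finset.sum_congr rfl fun z _ => ?_
      push_cast
      ring
    rw [this, norm_div, norm_real, Real.norm_eq_abs, abs_of_nonneg (Real.sqrt_nonneg _),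
      div_le_iff₀ (lt_of_lt_of_le hcpos hcZ)]
    exact hlim.trans (by gcongr)

/-! ### Two reflections as a rotation -/

/-- The product of the reflection about `φ` and a self-inverse isometry `X` acts on the plane
spanned by `φ` and `X φ` as the rotation by `arccos ⟪φ, X φ⟫`. -/
theorem exists_rotation_of_reflections {E : Type*} [NormedAddCommGroup E] [InnerProductSpace ℂ E]
    (X : E →ₗᵢ[ℂ] E) (hX : ∀ v, X (X v) = v) (φ : E) (hφ : ‖φ‖ = 1) (r : ℝ)
    (hr : inner ℂ φ (X φ) = (r : ℂ)) :
    ∃ ψ : E, ‖ψ‖ ≤ 1 ∧ ∀ (a : ℤ → E),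
      (∀ z, a z = ((Real.cos (z * Real.arccos r) : ℝ) : ℂ) • φ
        + ((Real.sin (z * Real.arccos r) : ℝ) : ℂ) • ψ) →
      ∀ z, ‖a z‖ = 1 ∧ X (a z) = a (1 - z) ∧ (2 * inner ℂ φ (a z)) • φ - a z = a (-z) := by
  have hXφ : ‖X φ‖ = 1 := by rw [X.norm_map, hφ]
  have hrabs : |r| ≤ 1 := by
    have := norm_inner_le_norm (𝕜 := ℂ) φ (X φ)
    rwa [hr, hφ, hXφ, Complex.norm_real, Real.norm_eq_abs, mul_one] at this
  obtain ⟨hr1, hr2⟩ := abs_le.mp hrabs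
  set θ := Real.arccos r with hθ
  have hcos : Real.cos θ = r := Real.cos_arccos hr1 hr2
  have hsin : Real.sin θ ^ 2 = 1 - r ^ 2 := by rw [Real.sin_sq, hcos]
  have hφφ : inner ℂ φ φ = (1 : ℂ) := by
    rw [inner_self_eq_norm_sq_to_K, hφ]; norm_num
  have hnorm : ‖X φ - (r : ℂ) • φ‖ ^ 2 = Real.sin θ ^ 2 := by
    rw [@norm_sub_sq ℂ, hXφ, norm_smul, hφ, inner_smul_right, ← inner_conj_symm, hr, hsin]
    simp
    ring
  -- Gram–Schmidt applied to $\varphi, X\varphi$. If $\sin\theta = 0$ the plane degenerates to a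
  -- line and $\psi = 0$ serves.
  obtain ⟨ψ, hψ, hXdec, hψ0⟩ : ∃ ψ : E, (Real.sin θ ≠ 0 → ‖ψ‖ = 1) ∧
      X φ = ((r : ℝ) : ℂ) • φ + ((Real.sin θ : ℝ) : ℂ) • ψ ∧ (Real.sin θ = 0 → ψ = 0) := by
    by_cases hs : Real.sin θ = 0
    · refine ⟨0, fun h => absurd hs h, ?_, fun _ => rfl⟩
      rw [hs, zero_pow two_ne_zero, sq_eq_zero_iff, norm_eq_zero, sub_eq_zero] at hnorm
      simpa using hnorm
    · have hsc : ((Real.sin θ : ℝ) : ℂ) ≠ 0 := by exact_mod_cast hs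
      refine ⟨((Real.sin θ : ℝ) : ℂ)⁻¹ • (X φ - (r : ℂ) • φ), fun _ => ?_, ?_, fun h => absurd h hs⟩
      · rw [← sq_eq_sq₀ (norm_nonneg _) zero_le_one, norm_smul, mul_pow, hnorm, norm_inv,
          Complex.norm_real, Real.norm_eq_abs, inv_pow, sq_abs]
        field_simp
      · rw [smul_smul, mul_inv_cancel₀ hsc, one_smul]
        abel
  have hψ1 : ‖ψ‖ ≤ 1 := by
    by_cases hs : Real.sin θ = 0
    · rw [hψ0 hs]; simp
    · exact (hψ hs).le
  have horth : inner ℂ φ ψ = (0 : ℂ) := by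
    by_cases hs : Real.sin θ = 0
    · rw [hψ0 hs]; simp
    · have hsc : ((Real.sin θ : ℝ) : ℂ) ≠ 0 := by exact_mod_cast hs
      rw [hXdec, inner_add_right, inner_smul_right, inner_smul_right, hφφ, mul_one] at hr
      exact (mul_eq_zero.mp (add_eq_left.mp hr)).resolve_left hsc
  -- Apply $X$ to the decomposition of $X\varphi$ and use $X^2 = 1$.
  have hXψ : X ψ = ((Real.sin θ : ℝ) : ℂ) • φ - ((r : ℝ) : ℂ) • ψ := by
    by_cases hs : Real.sin θ = 0
    · rw [hψ0 hs, hs]; simp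
    · have hsc : ((Real.sin θ : ℝ) : ℂ) ≠ 0 := by exact_mod_cast hs
      have h1 : ((Real.sin θ : ℝ) : ℂ) • X ψ = φ - (r : ℂ) • X φ := by
        have := congrArg X hXdec
        rw [hX, map_add, map_smul, map_smul] at this
        rw [eq_sub_iff_add_eq, add_comm, ← this]
      have h2 : ((Real.sin θ : ℝ) : ℂ) ^ 2 = 1 - (r : ℂ) ^ 2 := by exact_mod_cast hsin
      refine smul_right_injective E hsc ?_
      simp only
      rw [h1, hXdec, smul_sub, smul_add, smul_smul, smul_smul, smul_smul, smul_smul, ← pow_two,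
        ← pow_two, h2, sub_smul, one_smul, mul_comm (r : ℂ)]
      abel
  refine ⟨ψ, hψ1, fun a ha z => ⟨?_, ?_, ?_⟩⟩
  · rw [← sq_eq_sq₀ (norm_nonneg _) zero_le_one, ha, @norm_add_sq ℂ, inner_smul_left,
      inner_smul_right, horth, norm_smul, norm_smul, hφ, Complex.norm_real, Complex.norm_real,
      Real.norm_eq_abs, Real.norm_eq_abs, mul_pow, mul_pow, sq_abs, sq_abs]
    by_cases hs : Real.sin θ = 0
    · obtain ⟨m, hm⟩ := Real.sin_eq_zero_iff.mp hs
      have : Real.sin (z * θ) = 0 := by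
        rw [← hm, ← mul_assoc]
        exact_mod_cast Real.sin_int_mul_pi (z * m)
      have h2 := Real.sin_sq_add_cos_sq (z * θ)
      rw [this] at h2 ⊢
      simp at h2 ⊢
      exact_mod_cast h2
    · rw [hψ hs]
      simp
  · have e1 : (((1 - z : ℤ) : ℝ) * θ) = θ - z * θ := by push_cast; ring
    rw [ha, ha, e1, Real.cos_sub, Real.sin_sub, map_add, map_smul, map_smul, hXdec, hXψ, hcos]
    push_cast
    module
  · have e1 : (((-z : ℤ) : ℝ) * θ) = -(z * θ) := by push_cast; ring
    rw [ha, ha, e1, Real.cos_neg, Real.sin_neg, inner_add_right, inner_smul_right,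
      inner_smul_right, hφφ, horth]
    push_cast
    module

theorem EuclideanSpace.inner_toLp_eq_sum {R : Type*} [Fintype R] (u v : R → ℂ) :
    inner ℂ (WithLp.toLp 2 u : EuclideanSpace ℂ R) (WithLp.toLp 2 v) = ∑ x, star (u x) * v x := by
  simp [PiLp.inner_apply, mul_comm]

theorem EuclideanSpace.norm_toLp_sq {R : Type*} [Fintype R] (u : R → ℂ) :
    ‖(WithLp.toLp 2 u : EuclideanSpace ℂ R)‖ ^ 2 = ∑ x, ‖u x‖ ^ 2 := by
  rw [EuclideanSpace.norm_sq_eq]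

open Complex in
/-- Coordinate form of `exists_rotation_of_reflections` for the involution flipping the first
qubit, with the eigen-decomposition of the rotated vectors. -/
theorem exists_walk {Y : Type*} [Fintype Y] (φ : Bool × Y → ℂ) (hφ : ∑ x, ‖φ x‖ ^ 2 = 1) (r : ℝ)
    (hr : ∑ x : Bool × Y, star (φ x) * φ (!x.1, x.2) = (r : ℂ)) :
    ∃ a : ℤ → Bool × Y → ℂ, a 0 = φ ∧ (∀ z, ∑ x, ‖a z x‖ ^ 2 = 1) ∧
      (∀ z x, a z (!x.1, x.2) = a (1 - z) x) ∧
      (∀ z x, 2 * (∑ x', star (φ x') * a z x') * φ x - a z x = a (-z) x) ∧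
      ∃ α β : Bool × Y → ℂ, ∑ x, (‖α x‖ ^ 2 + ‖β x‖ ^ 2) ≤ 1 ∧
        ∀ z x, a z x = exp (z * (Real.arccos r : ℝ) * I) * α x
          + exp (z * (-Real.arccos r : ℝ) * I) * β x := by
  let σ : Bool × Y ≃ Bool × Y := Equiv.prodCongr Equiv.boolNot (Equiv.refl Y)
  let X := LinearIsometryEquiv.piLpCongrLeft 2 ℂ ℂ σ
  have hXa : ∀ (u : Bool × Y → ℂ), X (WithLp.toLp 2 u) = WithLp.toLp 2 fun x => u (!x.1, x.2) := by
    intro u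
    ext x
    simp [X, LinearIsometryEquiv.piLpCongrLeft_apply, σ, Equiv.piCongrLeft']
    rfl
  have hXX : ∀ v, X (X v) = v := by
    intro v
    obtain ⟨u, rfl⟩ := (WithLp.equiv 2 (Bool × Y → ℂ)).symm.surjective v
    change X (X (WithLp.toLp 2 u)) = WithLp.toLp 2 u
    rw [hXa, hXa]
    simp
  have hφ' : ‖(WithLp.toLp 2 φ : EuclideanSpace ℂ (Bool × Y))‖ = 1 := by
    rw [← sq_eq_sq₀ (norm_nonneg _) zero_le_one, EuclideanSpace.norm_toLp_sq, hφ, one_pow]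
  obtain ⟨ψ, hψ, h⟩ := exists_rotation_of_reflections X.toLinearIsometry hXX
    (WithLp.toLp 2 φ) hφ' r (by
      change inner ℂ _ (X _) = _
      rw [hXa, EuclideanSpace.inner_toLp_eq_sum, hr])
  set θ := Real.arccos r
  let a : ℤ → Bool × Y → ℂ := fun z x => ((Real.cos (z * θ) : ℝ) : ℂ) * φ x
    + ((Real.sin (z * θ) : ℝ) : ℂ) * ψ x
  have ha := h (fun z => WithLp.toLp 2 (a z)) (fun z => by ext x; simp [a])
  -- The two functions are the components of $\varphi$ with phases $e^{i\theta}$ and $e^{-i\theta}$.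
  refine ⟨a, ?_, ?_, ?_, ?_, fun x => (φ x - I * ψ x) / 2, fun x => (φ x + I * ψ x) / 2, ?_, ?_⟩
  · funext x; simp [a]
  · intro z
    rw [← EuclideanSpace.norm_toLp_sq, (ha z).1, one_pow]
  · intro z x
    have h2 := (ha z).2.1
    change X _ = _ at h2
    rw [hXa] at h2
    exact congrFun (congrArg WithLp.ofLp h2) x
  · intro z x
    have h2 := (ha z).2.2
    rw [EuclideanSpace.inner_toLp_eq_sum] at h2
    exact congrFun (congrArg WithLp.ofLp h2) x
  · have hpt : ∀ u v : ℂ, ‖(u - I * v) / 2‖ ^ 2 + ‖(u + I * v) / 2‖ ^ 2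
        = (‖u‖ ^ 2 + ‖v‖ ^ 2) / 2 := by
      intro u v
      simp only [← normSq_eq_norm_sq, normSq_apply]
      simp
      ring
    simp only [hpt]
    rw [← Finset.sum_div, Finset.sum_add_distrib, hφ, ← EuclideanSpace.norm_sq_eq]
    nlinarith [norm_nonneg ψ]
  · intro z x
    have e1 : (z * (θ : ℝ) * I : ℂ) = ((z * θ : ℝ) : ℂ) * I := by push_cast; ring
    have e2 : (z * (-θ : ℝ) * I : ℂ) = ((-(z * θ) : ℝ) : ℂ) * I := by push_cast; ring
    rw [e1, e2, exp_mul_I, exp_mul_I, ← ofReal_cos, ← ofReal_sin, ← ofReal_cos, ← ofReal_sin,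
      Real.cos_neg, Real.sin_neg]
    simp only [a]
    push_cast
    linear_combination (Complex.sin (z * θ) * ψ x) * I_sq

/-! ### Signed Fourier transform and phase estimation -/

/-- The matrix of the Fourier transform from the signed integers of `b + 1` qubits. -/
noncomputable def signedDFT (b : ℕ) : Matrix (Fin (2 ^ (b + 1))) (Fin (2 ^ (b + 1))) ℂ :=
  fun q s => Complex.exp (signedValue b s * (-(2 * Real.pi * q / 2 ^ (b + 1)) : ℝ) * Complex.I)
    / (Real.sqrt (2 ^ (b + 1)) : ℝ)

open Complex in
theorem signedDFT_mul_star (b : ℕ) : signedDFT b * star (signedDFT b) = 1 := by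
  have hQ : (0 : ℝ) < 2 ^ (b + 1) := by positivity
  ext q q'
  rw [Matrix.mul_apply, Matrix.one_apply]
  have hterm : ∀ s, signedDFT b q s * star (signedDFT b) s q' =
      exp ((-(2 * Real.pi * ((q : ℝ) - q') / 2 ^ (b + 1)) : ℝ) * I) ^ (s : ℕ)
        * (exp (-(2 ^ b) * (-(2 * Real.pi * ((q : ℝ) - q') / 2 ^ (b + 1)) : ℝ) * I)
          / 2 ^ (b + 1)) := by
    intro s
    have h1 : ((Real.sqrt (2 ^ (b + 1)) : ℝ) : ℂ) * (Real.sqrt (2 ^ (b + 1)) : ℝ)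
        = 2 ^ (b + 1) := by
      rw [← ofReal_mul, Real.mul_self_sqrt hQ.le]; push_cast; rfl
    simp only [signedDFT, Matrix.star_apply, RCLike.star_def, map_div₀, ← exp_conj, conj_ofReal,
      map_mul, conj_I, map_intCast]
    rw [div_mul_div_comm, ← exp_add, h1, ← exp_nat_mul, ← mul_div_assoc, ← exp_add]
    congr 2
    simp only [signedValue]
    push_cast
    field_simp
    ring
  simp only [hterm]
  rw [← Finset.sum_mul, Fin.sum_univ_eq_sum_range
    (fun s => exp ((-(2 * Real.pi * ((q : ℝ) - q') / 2 ^ (b + 1)) : ℝ) * I) ^ s) (2 ^ (b + 1))]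
  by_cases hqq : q = q'
  · subst hqq
    simp
  · rw [if_neg hqq, geom_sum_eq, ← exp_nat_mul, exp_eq_one_iff.mpr, sub_self, zero_div, zero_mul]
    · refine ⟨(q' : ℤ) - q, ?_⟩
      push_cast
      field_simp
      ring
    · intro h
      rw [exp_eq_one_iff] at h
      obtain ⟨m, hm⟩ := h
      have h2 : (-(2 * Real.pi * ((q : ℝ) - q') / 2 ^ (b + 1)) : ℝ) = m * (2 * Real.pi) := by
        have := mul_right_cancel₀ I_ne_zero (hm.trans (mul_assoc _ _ _).symm)
        exact_mod_cast this
      have h3 : ((q' : ℝ) - q) = m * 2 ^ (b + 1) := by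
        field_simp at h2
        linarith
      have h4 : ((q' : ℤ) - q) = m * 2 ^ (b + 1) := by exact_mod_cast h3
      have hq : ((q : ℕ) : ℤ) < 2 ^ (b + 1) := by exact_mod_cast q.isLt
      have hq' : ((q' : ℕ) : ℤ) < 2 ^ (b + 1) := by exact_mod_cast q'.isLt
      have hm0 : m = 0 := by
        have hp : (0 : ℤ) < 2 ^ (b + 1) := by positivity
        have : |m * 2 ^ (b + 1)| < 2 ^ (b + 1) := by
          rw [← h4, abs_lt]; constructor <;> omega
        rw [abs_mul, abs_of_pos hp] at this
        have : |m| < 1 := by nlinarith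
        exact Int.abs_lt_one_iff.mp this
      rw [hm0, zero_mul] at h4
      exact hqq (Fin.ext (by omega))

theorem signedDFT_mem_unitaryGroup (b : ℕ) :
    signedDFT b ∈ Matrix.unitaryGroup (Fin (2 ^ (b + 1))) ℂ :=
  Matrix.mem_unitaryGroup_iff.mpr (signedDFT_mul_star b)

theorem Matrix.sum_norm_sq_mulVec_of_mem_unitaryGroup {S : Type*} [Fintype S] [DecidableEq S]
    {F : Matrix S S ℂ} (hF : F ∈ Matrix.unitaryGroup S ℂ) (v : S → ℂ) :
    ∑ q, ‖∑ s, F q s * v s‖ ^ 2 = ∑ s, ‖v s‖ ^ 2 := by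
  have key : ∀ u : S → ℂ, ((∑ s, ‖u s‖ ^ 2 : ℝ) : ℂ) = star u ⬝ᵥ u := by
    intro u
    push_cast
    simp only [dotProduct, Pi.star_apply]
    refine Finset.sum_congr rfl fun s _ => ?_
    rw [RCLike.star_def, Complex.conj_mul']
  have h1 := key (F.mulVec v)
  rw [Matrix.star_mulVec, Matrix.dotProduct_mulVec, Matrix.vecMul_vecMul,
    ← Matrix.star_eq_conjTranspose, Matrix.mem_unitaryGroup_iff'.mp hF, Matrix.vecMul_one,
    ← key] at h1
  exact_mod_cast h1

open Complex in
/-- Phase estimation of one rotation with the window `g`: outcomes off by more than the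
concentration scale of the window have probability at most `2 τ ^ 2`. -/
theorem sum_bad_signedDFT_le {Y : Type*} [Fintype Y] (b : ℕ) (g : Fin (2 ^ (b + 1)) → ℝ)
    {δ τ θ : ℝ}
    (hg : ∀ x : ℝ, (∀ k : ℤ, δ ≤ |x - 2 * Real.pi * k|) →
        ‖∑ s, (g s : ℂ) * exp (signedValue b s * x * I)‖ ≤ τ)
    (a : ℤ → Y → ℂ) (α β : Y → ℂ) (hαβ : ∑ x, (‖α x‖ ^ 2 + ‖β x‖ ^ 2) ≤ 1)
    (ha : ∀ z x, a z x = exp (z * θ * I) * α x + exp (z * (-θ : ℝ) * I) * β x)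
    (bad : Finset (Fin (2 ^ (b + 1))))
    (hbad : ∀ q ∈ bad, δ < |Real.cos (2 * Real.pi * q / 2 ^ (b + 1)) - Real.cos θ|) :
    ∑ q ∈ bad, ∑ x, ‖∑ s, signedDFT b q s * (g s * a (signedValue b s) x)‖ ^ 2 ≤ 2 * τ ^ 2 := by
  have hQ : (0 : ℝ) < 2 ^ (b + 1) := by positivity
  -- Cosine is 1-Lipschitz and $2\pi$-periodic. Being even, it also makes the two phases $\pm\theta$
  -- yield the same estimate.
  have hcos : ∀ ω t : ℝ, δ < |Real.cos ω - Real.cos t| →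
      ∀ k : ℤ, δ ≤ |t - ω - 2 * Real.pi * k| := by
    intro ω t h k
    have h1 : Real.cos (ω + k * (2 * Real.pi)) = Real.cos ω := Real.cos_add_int_mul_two_pi ω k
    rw [← h1, abs_sub_comm] at h
    have h2 := Real.abs_cos_sub_cos_le t (ω + k * (2 * Real.pi))
    rw [show t - ω - 2 * Real.pi * k = t - (ω + k * (2 * Real.pi)) by ring]
    linarith
  -- The normalisation of the transform gives each bad outcome a factor $2^{-(b+1)}$, which balances
  -- the number of outcomes. The 2 comes from $(u+v)^2 \le 2u^2 + 2v^2$.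
  have hone : ∀ q ∈ bad, ∑ x, ‖∑ s, signedDFT b q s * (g s * a (signedValue b s) x)‖ ^ 2
      ≤ 2 * τ ^ 2 / 2 ^ (b + 1) := by
    intro q hq
    set ω : ℝ := 2 * Real.pi * q / 2 ^ (b + 1) with hω
    have h1 := hg (θ - ω) (hcos ω θ (hbad q hq))
    have h2 := hg (-θ - ω) (hcos ω (-θ) (by rw [Real.cos_neg]; exact hbad q hq))
    set D1 := ∑ s, (g s : ℂ) * exp (signedValue b s * (θ - ω : ℝ) * I)
    set D2 := ∑ s, (g s : ℂ) * exp (signedValue b s * (-θ - ω : ℝ) * I)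
    have hx : ∀ x, ∑ s, signedDFT b q s * (g s * a (signedValue b s) x)
        = (D1 * α x + D2 * β x) / (Real.sqrt (2 ^ (b + 1)) : ℝ) := by
      intro x
      rw [Finset.sum_mul, Finset.sum_mul, ← Finset.sum_add_distrib, Finset.sum_div]
      refine Finset.sum_congr rfl fun s _ => ?_
      have e1 : exp (signedValue b s * (θ - ω : ℝ) * I)
          = exp (signedValue b s * (-ω : ℝ) * I) * exp (signedValue b s * θ * I) := by
        rw [← exp_add]; congr 1; push_cast; ring
      have e2 : exp (signedValue b s * (-θ - ω : ℝ) * I)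
          = exp (signedValue b s * (-ω : ℝ) * I) * exp (signedValue b s * (-θ : ℝ) * I) := by
        rw [← exp_add]; congr 1; push_cast; ring
      rw [e1, e2, ha]
      simp only [signedDFT, ← hω]
      ring
    have hpt : ∀ x, ‖∑ s, signedDFT b q s * (g s * a (signedValue b s) x)‖ ^ 2
        ≤ 2 * τ ^ 2 / 2 ^ (b + 1) * (‖α x‖ ^ 2 + ‖β x‖ ^ 2) := by
      intro x
      rw [hx, norm_div, norm_real, Real.norm_eq_abs, abs_of_nonneg (Real.sqrt_nonneg _), div_pow,
        Real.sq_sqrt hQ.le, div_mul_eq_mul_div]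
      gcongr
      have h3 : ‖D1 * α x + D2 * β x‖ ≤ τ * (‖α x‖ + ‖β x‖) := by
        refine (norm_add_le _ _).trans ?_
        rw [norm_mul, norm_mul, mul_add]
        gcongr
      calc _ ≤ (τ * (‖α x‖ + ‖β x‖)) ^ 2 := pow_le_pow_left₀ (norm_nonneg _) h3 2
        _ ≤ _ := by nlinarith [mul_nonneg (sq_nonneg τ) (sq_nonneg (‖α x‖ - ‖β x‖))]
    refine (Finset.sum_le_sum fun x _ => hpt x).trans ?_
    rw [← Finset.mul_sum]
    exact mul_le_of_le_one_right (by positivity) hαβ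
  refine (Finset.sum_le_sum hone).trans ?_
  rw [Finset.sum_const, nsmul_eq_mul]
  have hcard : (bad.card : ℝ) ≤ 2 ^ (b + 1) := by
    have := Finset.card_le_univ bad
    rw [Fintype.card_fin] at this
    exact_mod_cast this
  calc (bad.card : ℝ) * (2 * τ ^ 2 / 2 ^ (b + 1))
      ≤ 2 ^ (b + 1) * (2 * τ ^ 2 / 2 ^ (b + 1)) := by gcongr
    _ = 2 * τ ^ 2 := by field_simp

/-! ### Product states under a shared budget -/

/-- From $2\|u\|\|v\| \le t\|u\|^2 + \|v\|^2/t$. It bounds the effect of removing a small part $v$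
from an ideal amplitude $u$. -/
theorem one_sub_mul_sub_div_le_norm_sub_sq {t : ℝ} (ht : 0 < t) (u v : ℂ) :
    (1 - t) * ‖u‖ ^ 2 - 1 / t * ‖v‖ ^ 2 ≤ ‖u - v‖ ^ 2 := by
  have h1 : (‖u‖ - ‖v‖) ^ 2 ≤ ‖u - v‖ ^ 2 := by
    rw [← sq_abs (‖u‖ - ‖v‖)]
    exact pow_le_pow_left₀ (abs_nonneg _) (abs_norm_sub_norm_le u v) 2
  refine le_trans ?_ h1
  have h2 : 0 ≤ (t * ‖u‖ - ‖v‖) ^ 2 / t := by positivity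
  have h3 : (t * ‖u‖ - ‖v‖) ^ 2 / t = t * ‖u‖ ^ 2 - 2 * (‖u‖ * ‖v‖) + 1 / t * ‖v‖ ^ 2 := by
    field_simp
    ring
  nlinarith [sq_nonneg ‖v‖]

section Product

variable {ι S R : Type*} [Fintype ι] [DecidableEq ι] [Fintype R]

theorem sum_sum_prod_eq_prod {A : Type*} [CommSemiring A] (t : ι → Finset S) (f : ι → S → R → A) :
    ∑ s ∈ Fintype.piFinset t, ∑ x : ι → R, ∏ i, f i (s i) (x i) = ∏ i, ∑ q ∈ t i, ∑ y, f i q y := by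
  rw [Finset.prod_univ_sum]
  refine Finset.sum_congr rfl fun s _ => ?_
  rw [Finset.prod_univ_sum, Fintype.piFinset_univ]

variable [Fintype S]

/-- Tensor power of a matrix. -/
def Matrix.piPow (ι : Type*) [Fintype ι] {S : Type*} (F : Matrix S S ℂ) : Matrix (ι → S) (ι → S) ℂ :=
  fun q s => ∏ i, F (q i) (s i)

theorem Matrix.piPow_mem_unitaryGroup [DecidableEq S] {F : Matrix S S ℂ}
    (hF : F ∈ Matrix.unitaryGroup S ℂ) : F.piPow ι ∈ Matrix.unitaryGroup (ι → S) ℂ := by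
  rw [Matrix.mem_unitaryGroup_iff] at hF ⊢
  ext q q'
  have h : ∀ i, ∑ s, F (q i) s * star (F (q' i) s) = if q i = q' i then 1 else 0 := by
    intro i
    have := congrFun (congrFun hF (q i)) (q' i)
    rwa [Matrix.mul_apply, Matrix.one_apply] at this
  calc (F.piPow ι * star (F.piPow ι)) q q'
      = ∑ s : ι → S, ∏ i, F (q i) (s i) * star (F (q' i) (s i)) := by
        rw [Matrix.mul_apply]
        refine Finset.sum_congr rfl fun s _ => ?_
        rw [Finset.prod_mul_distrib, Matrix.star_apply]
        simp only [Matrix.piPow, star_prod]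
    _ = ∏ i, ∑ s, F (q i) s * star (F (q' i) s) := by
        rw [Finset.prod_univ_sum, Fintype.piFinset_univ]
    _ = _ := by
        simp only [h, Matrix.one_apply]
        by_cases hq : q = q'
        · simp [hq]
        · obtain ⟨i, hi⟩ := Function.ne_iff.mp hq
          rw [if_neg hq]
          exact Finset.prod_eq_zero (Finset.mem_univ i) (if_neg hi)

/-- The part of a superposition in which the total weight of the registers is within budget. -/
def budget (w : S → ℕ) (L : ℕ) : Finset (ι → S) := {s | ∑ i, w (s i) ≤ L}

/-- Markov's inequality for the total weight under a product distribution; expectations add, so the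
bound is linear in the number of registers. -/
theorem sum_not_mem_budget_le [DecidableEq S] (f : ι → S → R → ℝ) (hf : ∀ i s x, 0 ≤ f i s x)
    (hf1 : ∀ i, ∑ s, ∑ x, f i s x = 1) (w : S → ℕ) {E : ℝ}
    (hE : ∀ i, ∑ s, ∑ x, w s * f i s x ≤ E) (L : ℕ) :
    L * ∑ s ∈ (budget w L : Finset (ι → S))ᶜ, ∑ x : ι → R, ∏ i, f i (s i) (x i)
      ≤ Fintype.card ι * E := by
  have hnn : ∀ s : ι → S, 0 ≤ ∑ x : ι → R, ∏ i, f i (s i) (x i) := fun s =>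
    Finset.sum_nonneg fun x _ => Finset.prod_nonneg fun i _ => hf _ _ _
  have hmean : ∀ i, ∑ s : ι → S, ∑ x : ι → R, w (s i) * ∏ j, f j (s j) (x j) ≤ E := by
    intro i
    -- The weight of register `i` is absorbed into its own factor, so the sum still factorises.
    have h1 : ∀ (s : ι → S) (x : ι → R), w (s i) * ∏ j, f j (s j) (x j)
        = ∏ j, (if j = i then (w (s j) : ℝ) * f j (s j) (x j) else f j (s j) (x j)) := by
      intro s x
      rw [← Finset.mul_prod_erase _ _ (Finset.mem_univ i),
        ← Finset.mul_prod_erase _ _ (Finset.mem_univ i), if_pos rfl, mul_assoc]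
      congr 2
      refine Finset.prod_congr rfl fun j hj => ?_
      rw [if_neg (Finset.ne_of_mem_erase hj)]
    simp only [h1]
    have h2 := sum_sum_prod_eq_prod (fun _ : ι => (Finset.univ : Finset S))
      (fun j s (x : R) => if j = i then (w s : ℝ) * f j s x else f j s x)
    rw [Fintype.piFinset_univ] at h2
    rw [h2, ← Finset.mul_prod_erase _ _ (Finset.mem_univ i), Finset.prod_eq_one, mul_one]
    · simpa using hE i
    · intro j hj
      simp only [if_neg (Finset.ne_of_mem_erase hj), hf1]
  calc _ = ∑ s ∈ (budget w L : Finset (ι → S))ᶜ, L * ∑ x : ι → R, ∏ i, f i (s i) (x i) := by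
        rw [Finset.mul_sum]
    _ ≤ ∑ s ∈ (budget w L : Finset (ι → S))ᶜ, (∑ i, (w (s i) : ℝ))
          * ∑ x : ι → R, ∏ i, f i (s i) (x i) := by
        refine Finset.sum_le_sum fun s hs => mul_le_mul_of_nonneg_right ?_ (hnn s)
        simp only [budget, Finset.mem_compl, Finset.mem_filter, Finset.mem_univ, true_and,
          not_le] at hs
        exact_mod_cast hs.le
    _ ≤ ∑ s : ι → S, (∑ i, (w (s i) : ℝ)) * ∑ x : ι → R, ∏ i, f i (s i) (x i) :=
        Finset.sum_le_sum_of_subset_of_nonneg (Finset.subset_univ _) fun s _ _ =>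
          mul_nonneg (Finset.sum_nonneg fun i _ => Nat.cast_nonneg _) (hnn s)
    _ = ∑ i, ∑ s : ι → S, ∑ x : ι → R, w (s i) * ∏ j, f j (s j) (x j) := by
        rw [Finset.sum_comm]
        refine Finset.sum_congr rfl fun s _ => ?_
        rw [Finset.sum_mul]
        simp only [Finset.mul_sum]
    _ ≤ ∑ _i : ι, E := Finset.sum_le_sum fun i _ => hmean i
    _ = _ := by simp

theorem sum_compl_budget_le_sq [DecidableEq S] (f : ι → S → R → ℝ) (hf : ∀ i s x, 0 ≤ f i s x)
    (hf1 : ∀ i, ∑ s, ∑ x, f i s x = 1) (w : S → ℕ) {E κ : ℝ}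
    (hE : ∀ i, ∑ s, ∑ x, w s * f i s x ≤ E) (L : ℕ) (hL : 0 < L)
    (hEL : Fintype.card ι * E ≤ κ ^ 2 * L) :
    ∑ s ∈ (budget w L : Finset (ι → S))ᶜ, ∑ x : ι → R, ∏ i, f i (s i) (x i) ≤ κ ^ 2 := by
  have h2 := (sum_not_mem_budget_le f hf hf1 w hE L).trans hEL
  rw [mul_comm (κ ^ 2)] at h2
  exact le_of_mul_le_mul_left h2 (by exact_mod_cast hL)

/-- The mass of the retained branches: its positivity permits renormalising them, and the upper
bound makes this only increase probabilities. -/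
theorem sum_prod_budget_bounds [DecidableEq S] (f : S → ℝ) (hf : ∀ s, 0 ≤ f s)
    (hf1 : ∑ s, f s = 1) (w : S → ℕ) {E κ : ℝ} (hE : ∑ s, w s * f s ≤ E) (L : ℕ) (hL : 0 < L)
    (hEL : Fintype.card ι * E ≤ κ ^ 2 * L) :
    1 - κ ^ 2 ≤ ∑ s ∈ (budget w L : Finset (ι → S)), ∏ i, f (s i) ∧
      ∑ s ∈ (budget w L : Finset (ι → S)), ∏ i, f (s i) ≤ 1 := by
  have h := sum_compl_budget_le_sq (ι := ι) (R := Unit) (fun _ s _ => f s) (fun _ s _ => hf s)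
    (fun _ => by simpa using hf1) w (fun _ => by simpa using hE) L hL hEL
  have htot : ∑ s : ι → S, ∏ i, f (s i) = 1 := by
    rw [← Fintype.piFinset_univ, ← Finset.prod_univ_sum]
    exact Finset.prod_eq_one fun _ _ => hf1
  have hsplit := Finset.sum_add_sum_compl (budget w L : Finset (ι → S)) (fun s => ∏ i, f (s i))
  have hnn : 0 ≤ ∑ s ∈ (budget w L : Finset (ι → S))ᶜ, ∏ i, f (s i) :=
    Finset.sum_nonneg fun s _ => Finset.prod_nonneg fun i _ => hf _
  simp only [Finset.univ_unique, Finset.sum_const, Finset.card_singleton, one_smul] at h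
  constructor <;> linarith

/-- Measuring a product state after a tensor power of a unitary `F`, but with the superposition
restricted to a budget that the weight exceeds with small probability. -/
theorem one_sub_le_sum_good_budget [DecidableEq S] {F : Matrix S S ℂ}
    (hF : F ∈ Matrix.unitaryGroup S ℂ) (h : ι → S → R → ℂ)
    (h1 : ∀ i, ∑ s, ∑ x, ‖h i s x‖ ^ 2 = 1) (w : S → ℕ) {E κ τ : ℝ}
    (hE : ∀ i, ∑ s, ∑ x, w s * ‖h i s x‖ ^ 2 ≤ E) (L : ℕ) (hL : 0 < L)
    (hEL : Fintype.card ι * E ≤ κ ^ 2 * L) (hκ : 0 < κ) (hκ1 : κ < 1)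
    (good : ι → Finset S) (hτ : Fintype.card ι * τ ≤ κ) (hτ1 : τ ≤ 1)
    (hgood : ∀ i, 1 - τ ≤ ∑ q ∈ good i, ∑ x, ‖∑ s, F q s * h i s x‖ ^ 2) :
    1 - 3 * κ ≤ ∑ q ∈ Fintype.piFinset good, ∑ x : ι → R,
      ‖∑ s ∈ budget w L, F.piPow ι q s * ∏ i, h i (s i) (x i)‖ ^ 2 := by
  have hbadsum := sum_compl_budget_le_sq (fun i s x => ‖h i s x‖ ^ 2) (fun _ _ _ => sq_nonneg _) h1
    w hE L hL hEL
  have hideal : 1 - κ ≤ ∑ q ∈ Fintype.piFinset good, ∑ x : ι → R,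
      ‖∑ s, F.piPow ι q s * ∏ i, h i (s i) (x i)‖ ^ 2 := by
    -- Without the budget the registers are independent, and Bernoulli's inequality gives
    -- $(1-\tau)^{|\iota|} \ge 1 - \kappa$.
    have hfac : ∀ (q : ι → S) (x : ι → R), ∑ s, F.piPow ι q s * ∏ i, h i (s i) (x i)
        = ∏ i, ∑ s, F (q i) s * h i s (x i) := by
      intro q x
      rw [Finset.prod_univ_sum, Fintype.piFinset_univ]
      refine Finset.sum_congr rfl fun s _ => ?_
      rw [Finset.prod_mul_distrib]
      rfl
    simp only [hfac, norm_prod, ← Finset.prod_pow]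
    rw [sum_sum_prod_eq_prod good (fun i q x => ‖∑ s, F q s * h i s x‖ ^ 2)]
    calc 1 - κ ≤ 1 + (Fintype.card ι : ℝ) * (-τ) := by linarith
      _ ≤ (1 + (-τ)) ^ Fintype.card ι := one_add_mul_le_pow (by linarith) _
      _ = ∏ _i : ι, (1 - τ) := by simp [sub_eq_add_neg]
      _ ≤ _ := Finset.prod_le_prod (fun _ _ => by linarith) fun i _ => hgood i
  -- Extended to all outcomes, the sum is the norm of the dropped branches, which the tensor power
  -- preserves.
  have hrest : ∑ q ∈ Fintype.piFinset good, ∑ x : ι → R,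
      ‖∑ s ∈ (budget w L)ᶜ, F.piPow ι q s * ∏ i, h i (s i) (x i)‖ ^ 2 ≤ κ ^ 2 := by
    refine le_trans (Finset.sum_le_sum_of_subset_of_nonneg (Finset.subset_univ _) fun _ _ _ =>
      Finset.sum_nonneg fun _ _ => sq_nonneg _) ?_
    rw [Finset.sum_comm]
    have hx : ∀ x : ι → R, ∑ q : ι → S,
        ‖∑ s ∈ (budget w L)ᶜ, F.piPow ι q s * ∏ i, h i (s i) (x i)‖ ^ 2
        = ∑ s ∈ (budget w L)ᶜ, ∏ i, ‖h i (s i) (x i)‖ ^ 2 := by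
      intro x
      have := Matrix.sum_norm_sq_mulVec_of_mem_unitaryGroup
        (Matrix.piPow_mem_unitaryGroup (ι := ι) hF)
        (fun s => if s ∈ (budget w L)ᶜ then ∏ i, h i (s i) (x i) else 0)
      simp only [mul_ite, mul_zero] at this
      simp only [Finset.sum_ite_mem, Finset.univ_inter] at this
      rw [this]
      refine (Finset.sum_subset_zero_on_sdiff (Finset.subset_univ _) (fun s hs => ?_)
        fun s hs => ?_).symm
      · rw [if_neg (Finset.mem_sdiff.mp hs).2, norm_zero, zero_pow two_ne_zero]
      · rw [if_pos hs, norm_prod, Finset.prod_pow]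
    simp only [hx]
    rw [Finset.sum_comm]
    exact hbadsum
  have hpt : ∀ (q : ι → S) (x : ι → R),
      (1 - κ) * ‖∑ s, F.piPow ι q s * ∏ i, h i (s i) (x i)‖ ^ 2
        - 1 / κ * ‖∑ s ∈ (budget w L)ᶜ, F.piPow ι q s * ∏ i, h i (s i) (x i)‖ ^ 2
      ≤ ‖∑ s ∈ budget w L, F.piPow ι q s * ∏ i, h i (s i) (x i)‖ ^ 2 := by
    intro q x
    have := one_sub_mul_sub_div_le_norm_sub_sq hκ
      (∑ s, F.piPow ι q s * ∏ i, h i (s i) (x i))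
      (∑ s ∈ (budget w L)ᶜ, F.piPow ι q s * ∏ i, h i (s i) (x i))
    rw [← Finset.sum_add_sum_compl (budget w L), add_sub_cancel_right] at this
    rwa [← Finset.sum_add_sum_compl (budget w L)]
  calc 1 - 3 * κ ≤ (1 - κ) * (1 - κ) - 1 / κ * κ ^ 2 := by
        rw [one_div, pow_two, inv_mul_cancel_left₀ hκ.ne']
        nlinarith
    _ ≤ (1 - κ) * (∑ q ∈ Fintype.piFinset good, ∑ x : ι → R,
          ‖∑ s, F.piPow ι q s * ∏ i, h i (s i) (x i)‖ ^ 2)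
        - 1 / κ * (∑ q ∈ Fintype.piFinset good, ∑ x : ι → R,
          ‖∑ s ∈ (budget w L)ᶜ, F.piPow ι q s * ∏ i, h i (s i) (x i)‖ ^ 2) := by
        have : 0 ≤ 1 - κ := by linarith
        gcongr
    _ ≤ _ := by
        simp only [Finset.mul_sum, ← Finset.sum_sub_distrib]
        exact Finset.sum_le_sum fun q _ => Finset.sum_le_sum fun x _ => hpt q x

end Product

/-! ### Elementary unitaries -/

section Unitaries

variable {m o : Type*} [Fintype m] [DecidableEq m] [Fintype o] [DecidableEq o]

theorem Matrix.permMatrix_mem_unitaryGroup (σ : Equiv.Perm m) :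
    σ.permMatrix ℂ ∈ Matrix.unitaryGroup m ℂ := by
  rw [Matrix.mem_unitaryGroup_iff, Matrix.star_eq_conjTranspose, Matrix.conjTranspose_permMatrix,
    ← Matrix.permMatrix_mul, inv_mul_cancel, Matrix.permMatrix_one]

/-- The permutation matrix of an involution, as a unitary. -/
noncomputable def involutionUnitary (f : m → m) (hf : Function.Involutive f) :
    Matrix.unitaryGroup m ℂ :=
  ⟨(hf.toPerm f).permMatrix ℂ, Matrix.permMatrix_mem_unitaryGroup _⟩

theorem involutionUnitary_mulVec (f : m → m) (hf : Function.Involutive f) (v : m → ℂ) :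
    (involutionUnitary f hf : Matrix m m ℂ).mulVec v = v ∘ f :=
  Matrix.permMatrix_mulVec _

/-- A block diagonal unitary. -/
def blockUnitary (V : o → Matrix.unitaryGroup m ℂ) : Matrix.unitaryGroup (m × o) ℂ :=
  ⟨Matrix.blockDiagonal fun s => (V s : Matrix m m ℂ), by
    rw [Matrix.mem_unitaryGroup_iff, Matrix.star_eq_conjTranspose,
      Matrix.blockDiagonal_conjTranspose, ← Matrix.blockDiagonal_mul]
    have : (fun s => (V s : Matrix m m ℂ) * (V s : Matrix m m ℂ).conjTranspose) = 1 := by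
      funext s
      exact Matrix.mem_unitaryGroup_iff.mp (V s).2
    rw [this, Matrix.blockDiagonal_one]⟩

theorem blockUnitary_mulVec (V : o → Matrix.unitaryGroup m ℂ) (v : m × o → ℂ) :
    (blockUnitary V : Matrix (m × o) (m × o) ℂ).mulVec v
      = fun x => (V x.2 : Matrix m m ℂ).mulVec (fun y => v (y, x.2)) x.1 := by
  funext x
  simp only [blockUnitary, Matrix.mulVec, dotProduct, Fintype.sum_prod_type,
    Matrix.blockDiagonal_apply]
  refine Finset.sum_congr rfl fun y _ => ?_
  simp [ite_mul]

/-- A unitary transported along a bijection of the basis states. -/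
def reindexUnitary (e : o ≃ m) (U : Matrix.unitaryGroup m ℂ) : Matrix.unitaryGroup o ℂ :=
  ⟨(U : Matrix m m ℂ).submatrix e e, by
    rw [Matrix.mem_unitaryGroup_iff, Matrix.star_eq_conjTranspose, Matrix.conjTranspose_submatrix,
      Matrix.submatrix_mul_equiv, ← Matrix.star_eq_conjTranspose,
      Matrix.mem_unitaryGroup_iff.mp U.2, Matrix.submatrix_one_equiv]⟩

theorem reindexUnitary_mulVec (e : o ≃ m) (U : Matrix.unitaryGroup m ℂ) (v : m → ℂ) :
    (reindexUnitary e U : Matrix o o ℂ).mulVec (v ∘ e) = (U : Matrix m m ℂ).mulVec v ∘ e := by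
  rw [reindexUnitary, Matrix.submatrix_mulVec_equiv]
  simp [Function.comp_assoc]

/-- Extend `v` to an orthonormal basis. This lets one uncharged gate create the initial
superposition of the counters. -/
theorem exists_unitary_mulVec_single (i : m) (v : m → ℂ) (hv : ∑ x, ‖v x‖ ^ 2 = 1) :
    ∃ U : Matrix.unitaryGroup m ℂ, (U : Matrix m m ℂ).mulVec (Pi.single i 1) = v := by
  let w : m → EuclideanSpace ℂ m := fun _ => WithLp.toLp 2 v
  have hw : Orthonormal ℂ (Set.domRestrict {i} w) := by
    refine ⟨fun j => ?_, fun j k hjk => absurd (Subsingleton.elim j k) hjk⟩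
    rw [← sq_eq_sq₀ (norm_nonneg _) zero_le_one, one_pow, ← hv]
    exact EuclideanSpace.norm_toLp_sq v
  obtain ⟨b, hb⟩ := hw.exists_orthonormalBasis_extension_of_card_eq (by simp)
  refine ⟨⟨_, (EuclideanSpace.basisFun m ℂ).toMatrix_orthonormalBasis_mem_unitary b⟩, ?_⟩
  funext x
  have := hb i rfl
  simp [Module.Basis.toMatrix_apply, this, w]

end Unitaries

/-! ### Preparing the pair state and reflecting about it -/

/-- Basis states of the control qubit, the two index registers and the data register. -/
abbrev ActiveState (d k n : ℕ) : Type := Bool × Fin d × Fin k × Fin (2 ^ n)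

section ActiveMaps

variable {d k n : ℕ}

/-- Controlled action of a matrix on the feature index and the data register. -/
noncomputable def featureMap (O : Matrix (Fin d × Fin (2 ^ n)) (Fin d × Fin (2 ^ n)) ℂ) :
    (ActiveState d k n → ℂ) →ₗ[ℂ] (ActiveState d k n → ℂ) where
  toFun v x := if x.1 = true then
      O.mulVec (fun q => v (x.1, q.1, x.2.2.1, q.2)) (x.2.1, x.2.2.2) else v x
  map_add' u v := by
    funext x
    by_cases hx : x.1 = true <;> simp [hx, Matrix.mulVec, dotProduct, mul_add,
      Finset.sum_add_distrib]
  map_smul' c v := by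
    funext x
    by_cases hx : x.1 = true <;> simp [hx, Matrix.mulVec, dotProduct, Finset.mul_sum,
      mul_left_comm]

/-- Controlled action of a matrix on the cluster index and the data register. -/
noncomputable def characteristicMap
    (O : Matrix (Fin k × Fin (2 ^ n)) (Fin k × Fin (2 ^ n)) ℂ) :
    (ActiveState d k n → ℂ) →ₗ[ℂ] (ActiveState d k n → ℂ) where
  toFun v x := if x.1 = true then
      O.mulVec (fun q => v (x.1, x.2.1, q.1, q.2)) (x.2.2.1, x.2.2.2) else v x
  map_add' u v := by
    funext x
    by_cases hx : x.1 = true <;> simp [hx, Matrix.mulVec, dotProduct, mul_add,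
      Finset.sum_add_distrib]
  map_smul' c v := by
    funext x
    by_cases hx : x.1 = true <;> simp [hx, Matrix.mulVec, dotProduct, Finset.mul_sum,
      mul_left_comm]

theorem featureMap_apply_of_true (O : Matrix (Fin d × Fin (2 ^ n)) (Fin d × Fin (2 ^ n)) ℂ)
    (v : ActiveState d k n → ℂ) (l : Fin d) (j : Fin k) (y : Fin (2 ^ n)) :
    featureMap O v (true, l, j, y) = ∑ q, O (l, y) q * v (true, q.1, j, q.2) := rfl

theorem featureMap_apply_of_false (O : Matrix (Fin d × Fin (2 ^ n)) (Fin d × Fin (2 ^ n)) ℂ)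
    (v : ActiveState d k n → ℂ) (x) : featureMap O v (false, x) = v (false, x) := rfl

theorem characteristicMap_apply_of_true
    (O : Matrix (Fin k × Fin (2 ^ n)) (Fin k × Fin (2 ^ n)) ℂ)
    (v : ActiveState d k n → ℂ) (l : Fin d) (j : Fin k) (y : Fin (2 ^ n)) :
    characteristicMap O v (true, l, j, y) = ∑ q, O (j, y) q * v (true, l, q.1, q.2) := rfl

theorem characteristicMap_apply_of_false
    (O : Matrix (Fin k × Fin (2 ^ n)) (Fin k × Fin (2 ^ n)) ℂ)
    (v : ActiveState d k n → ℂ) (x) : characteristicMap O v (false, x) = v (false, x) := rfl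

theorem featureMap_featureMap {O O' : Matrix (Fin d × Fin (2 ^ n)) (Fin d × Fin (2 ^ n)) ℂ}
    (h : O * O' = 1) (v : ActiveState d k n → ℂ) : featureMap O (featureMap O' v) = v := by
  funext ⟨c, l, j, y⟩
  cases c
  · rfl
  · change O.mulVec (O'.mulVec fun q => v (true, q.1, j, q.2)) (l, y) = _
    rw [Matrix.mulVec_mulVec, h, Matrix.one_mulVec]

theorem characteristicMap_characteristicMap
    {O O' : Matrix (Fin k × Fin (2 ^ n)) (Fin k × Fin (2 ^ n)) ℂ}
    (h : O * O' = 1) (v : ActiveState d k n → ℂ) :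
    characteristicMap O (characteristicMap O' v) = v := by
  funext ⟨c, l, j, y⟩
  cases c
  · rfl
  · change O.mulVec (O'.mulVec fun q => v (true, l, q.1, q.2)) (j, y) = _
    rw [Matrix.mulVec_mulVec, h, Matrix.one_mulVec]

/-- The NOT gate on the control qubit. -/
noncomputable def flipUnitary (d k n : ℕ) : Matrix.unitaryGroup (ActiveState d k n) ℂ :=
  involutionUnitary (fun x => (!x.1, x.2)) fun x => by simp

theorem flipUnitary_mulVec (v : ActiveState d k n → ℂ) :
    (flipUnitary d k n).1.mulVec v = fun x => v (!x.1, x.2) :=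
  involutionUnitary_mulVec _ _ v

/-- The matrix of the Hadamard gate. -/
noncomputable def hadamardMatrix : Matrix Bool Bool ℂ :=
  fun c c' => ((if c && c' then -1 else 1 : ℝ) / Real.sqrt 2 : ℝ)

theorem hadamardMatrix_mem_unitaryGroup : hadamardMatrix ∈ Matrix.unitaryGroup Bool ℂ := by
  have h : (1 / Real.sqrt 2) * (1 / Real.sqrt 2) = 1 / 2 := by
    rw [div_mul_div_comm, Real.mul_self_sqrt zero_le_two, one_mul]
  have h' : (-1 / Real.sqrt 2) * (-1 / Real.sqrt 2) = 1 / 2 := by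
    rw [div_mul_div_comm, Real.mul_self_sqrt zero_le_two]; norm_num
  have h'' : (1 / Real.sqrt 2) * (-1 / Real.sqrt 2) = -(1 / 2) := by
    rw [div_mul_div_comm, Real.mul_self_sqrt zero_le_two]; norm_num
  have h''' : (-1 / Real.sqrt 2) * (1 / Real.sqrt 2) = -(1 / 2) := by
    rw [div_mul_div_comm, Real.mul_self_sqrt zero_le_two]; norm_num
  rw [Matrix.mem_unitaryGroup_iff]
  ext c c'
  rw [Matrix.mul_apply, Fintype.sum_bool, Matrix.star_apply, Matrix.star_apply, Matrix.one_apply]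
  simp only [hadamardMatrix, RCLike.star_def, Complex.conj_ofReal, ← Complex.ofReal_mul,
    ← Complex.ofReal_add]
  cases c <;> cases c' <;> simp only [Bool.and_true, Bool.and_false, Bool.false_eq_true, if_true,
    if_false, h, h', h'', h'''] <;> norm_num

/-- The Hadamard gate on the control qubit. -/
noncomputable def hadamardUnitary (d k n : ℕ) : Matrix.unitaryGroup (ActiveState d k n) ℂ :=
  blockUnitary fun _ => ⟨hadamardMatrix, hadamardMatrix_mem_unitaryGroup⟩

theorem hadamardUnitary_mulVec (v : ActiveState d k n → ℂ) (x : ActiveState d k n) :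
    (hadamardUnitary d k n).1.mulVec v x
      = hadamardMatrix x.1 true * v (true, x.2) + hadamardMatrix x.1 false * v (false, x.2) := by
  rw [hadamardUnitary, blockUnitary_mulVec]
  simp [Matrix.mulVec, dotProduct]

theorem hadamardUnitary_hadamardUnitary (v : ActiveState d k n → ℂ) :
    (hadamardUnitary d k n).1.mulVec
      ((hadamardUnitary d k n).1.mulVec v) = v := by
  rw [Matrix.mulVec_mulVec]
  have h : star (hadamardUnitary d k n).1 = hadamardUnitary d k n := by
    change star (Matrix.blockDiagonal fun _ => hadamardMatrix)
      = Matrix.blockDiagonal fun _ => hadamardMatrix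
    rw [Matrix.star_eq_conjTranspose, Matrix.blockDiagonal_conjTranspose]
    congr 1
    funext _
    ext c c'
    simp [hadamardMatrix, Matrix.conjTranspose_apply, Bool.and_comm]
  have h2 := Matrix.mem_unitaryGroup_iff'.mp (hadamardUnitary d k n).2
  rw [h] at h2
  rw [h2, Matrix.one_mulVec]

/-- The reflection about a basis state with control qubit and data register zero. -/
noncomputable def reflectUnitary (n : ℕ) (p : Fin d × Fin k) :
    Matrix.unitaryGroup (ActiveState d k n) ℂ :=
  ⟨Matrix.diagonal fun x => if x = (false, p.1, p.2, 0) then 1 else -1, by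
    rw [Matrix.mem_unitaryGroup_iff, Matrix.star_eq_conjTranspose, Matrix.diagonal_conjTranspose,
      Matrix.diagonal_mul_diagonal, ← Matrix.diagonal_one]
    congr 1
    funext x
    simp only [Pi.star_apply]
    split_ifs <;> simp⟩

theorem reflectUnitary_mulVec (p : Fin d × Fin k) (v : ActiveState d k n → ℂ) :
    (reflectUnitary n p).1.mulVec v
      = (2 * v (false, p.1, p.2, 0)) • Pi.single (false, p.1, p.2, 0) 1 - v := by
  funext x
  rw [reflectUnitary, Matrix.mulVec_diagonal]
  by_cases hx : x = (false, p.1, p.2, 0)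
  · subst hx
    simp
    ring
  · simp [hx]

/-- The circuit preparing, controlled on the index registers, the superposition of the feature
state and of the characteristic state. -/
noncomputable def prepMap (Ox : Matrix (Fin d × Fin (2 ^ n)) (Fin d × Fin (2 ^ n)) ℂ)
    (Oxi : Matrix (Fin k × Fin (2 ^ n)) (Fin k × Fin (2 ^ n)) ℂ) :
    (ActiveState d k n → ℂ) →ₗ[ℂ] (ActiveState d k n → ℂ) :=
  characteristicMap Oxi ∘ₗ (flipUnitary d k n).1.mulVecLin ∘ₗ
    featureMap Ox ∘ₗ (hadamardUnitary d k n).1.mulVecLin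

/-- The inverse of `prepMap` if the inverses of the two matrices are given. -/
noncomputable def unprepMap (Ox : Matrix (Fin d × Fin (2 ^ n)) (Fin d × Fin (2 ^ n)) ℂ)
    (Oxi : Matrix (Fin k × Fin (2 ^ n)) (Fin k × Fin (2 ^ n)) ℂ) :
    (ActiveState d k n → ℂ) →ₗ[ℂ] (ActiveState d k n → ℂ) :=
  (hadamardUnitary d k n).1.mulVecLin ∘ₗ featureMap Ox ∘ₗ
    (flipUnitary d k n).1.mulVecLin ∘ₗ characteristicMap Oxi

theorem prepMap_unprepMap (Ox : Matrix.unitaryGroup (Fin d × Fin (2 ^ n)) ℂ)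
    (Oxi : Matrix.unitaryGroup (Fin k × Fin (2 ^ n)) ℂ) (v : ActiveState d k n → ℂ) :
    prepMap Ox.1 Oxi.1 (unprepMap Ox⁻¹.1 Oxi⁻¹.1 v) = v := by
  have h1 : Ox.1 * Ox⁻¹.1 = 1 :=
    congrArg Subtype.val (mul_inv_cancel Ox)
  have h2 : Oxi.1 * Oxi⁻¹.1 = 1 :=
    congrArg Subtype.val (mul_inv_cancel Oxi)
  simp only [prepMap, unprepMap, LinearMap.comp_apply, Matrix.mulVecLin_apply,
    hadamardUnitary_hadamardUnitary, featureMap_featureMap h1]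
  rw [show (flipUnitary d k n).1.mulVec ((flipUnitary d k n).1.mulVec
      (characteristicMap Oxi⁻¹.1 v))
      = characteristicMap Oxi⁻¹.1 v by
    rw [flipUnitary_mulVec, flipUnitary_mulVec]; funext x; simp]
  exact characteristicMap_characteristicMap h2 v

/-- A state of the control qubit and the data register, with fixed values of the two indices. -/
def sector (p : Fin d × Fin k) (u : Bool × Fin (2 ^ n) → ℂ) : ActiveState d k n → ℂ :=
  fun x => if (x.2.1, x.2.2.1) = p then u (x.1, x.2.2.2) else 0

/-- The superposition of the feature state and of the characteristic state. -/
noncomputable def pairState (x ξ : Fin (2 ^ n) → ℂ) : Bool × Fin (2 ^ n) → ℂ :=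
  fun q => (if q.1 = true then ξ q.2 else x q.2) / (Real.sqrt 2 : ℝ)

theorem sector_single_zero (p : Fin d × Fin k) :
    sector p (Pi.single (false, (0 : Fin (2 ^ n))) 1) = Pi.single (false, p.1, p.2, 0) 1 := by
  funext ⟨c, l, j, y⟩
  obtain ⟨l', j'⟩ := p
  simp only [sector, Pi.single_apply, Prod.mk.injEq]
  by_cases h1 : l = l' <;> by_cases h2 : j = j' <;> simp [h1, h2]

theorem flipUnitary_sector (p : Fin d × Fin k) (u : Bool × Fin (2 ^ n) → ℂ) :
    (flipUnitary d k n).1.mulVec (sector p u) = sector p fun q => u (!q.1, q.2) := by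
  rw [flipUnitary_mulVec]
  rfl

variable {Ox : Matrix.unitaryGroup (Fin d × Fin (2 ^ n)) ℂ}
  {Oxi : Matrix.unitaryGroup (Fin k × Fin (2 ^ n)) ℂ} {p : Fin d × Fin k}
  {x ξ : Fin (2 ^ n) → ℂ}

/-- Both oracles act only on control value 1: the feature state is written there, the NOT gate moves
it to control value 0, and the characteristic state is written into the vacated branch. -/
theorem prepMap_sector_single (hx : PreparesAt Ox p.1 x) (hξ : PreparesAt Oxi p.2 ξ) :
    prepMap Ox.1 Oxi.1 (sector p (Pi.single (false, 0) 1)) = sector p (pairState x ξ) := by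
  obtain ⟨l, j⟩ := p
  have hH : (hadamardUnitary d k n).1.mulVec
      (sector (l, j) (Pi.single (false, 0) 1))
      = sector (l, j) (fun q => if q.2 = 0 then ((1 / Real.sqrt 2 : ℝ) : ℂ) else 0) := by
    funext ⟨c, l', j', y⟩
    rw [hadamardUnitary_mulVec]
    by_cases h : (l', j') = (l, j) <;> by_cases h2 : y = 0 <;>
      simp [sector, h, h2, hadamardMatrix]
  have hF : featureMap Ox.1 (sector (l, j)
      (fun q => if q.2 = 0 then ((1 / Real.sqrt 2 : ℝ) : ℂ) else 0))
      = sector (l, j) (fun q => (if q.1 = true then x q.2 else if q.2 = 0 then 1 else 0)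
        / (Real.sqrt 2 : ℝ)) := by
    funext ⟨c, l', j', y⟩
    cases c
    · rw [featureMap_apply_of_false]
      by_cases h1 : (l', j') = (l, j) <;> by_cases h2 : y = 0 <;> simp [sector, h1, h2]
    · rw [featureMap_apply_of_true, Finset.sum_eq_single (l, 0)]
      · rw [hx l' y]
        by_cases h1 : l' = l <;> by_cases h2 : j' = j <;> simp [sector, h1, h2, div_eq_mul_inv]
      · intro q _ hq
        have : ¬ (q.1 = l ∧ q.2 = 0) := fun h => hq (Prod.ext h.1 h.2)
        by_cases h1 : q.1 = l <;> by_cases h2 : q.2 = 0 <;> simp_all [sector]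
      · simp
  have hC : characteristicMap Oxi.1 (sector (l, j)
      (fun q => (if (!q.1) = true then x q.2 else if q.2 = 0 then 1 else 0) / (Real.sqrt 2 : ℝ)))
      = sector (l, j) (pairState x ξ) := by
    funext ⟨c, l', j', y⟩
    cases c
    · rw [characteristicMap_apply_of_false]
      simp [sector, pairState]
    · rw [characteristicMap_apply_of_true, Finset.sum_eq_single (j, 0)]
      · rw [hξ j' y]
        by_cases h1 : l' = l <;> by_cases h2 : j' = j <;>
          simp [sector, pairState, h1, h2, div_eq_mul_inv]
      · intro q _ hq
        have : ¬ (q.1 = j ∧ q.2 = 0) := fun h => hq (Prod.ext h.1 h.2)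
        by_cases h1 : q.1 = j <;> by_cases h2 : q.2 = 0 <;> simp_all [sector]
      · simp
  simp only [prepMap, LinearMap.comp_apply, Matrix.mulVecLin_apply]
  rw [hH, hF, flipUnitary_sector, hC]

/-- `PreparesAt` fixes one column of each oracle, hence by conjugation one row of its inverse; only
that row enters this amplitude. -/
theorem unprepMap_sector_apply (hx : PreparesAt Ox p.1 x) (hξ : PreparesAt Oxi p.2 ξ)
    (u : Bool × Fin (2 ^ n) → ℂ) :
    unprepMap Ox⁻¹.1 Oxi⁻¹.1 (sector p u)
      (false, p.1, p.2, 0) = ∑ q, star (pairState x ξ q) * u q := by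
  obtain ⟨l, j⟩ := p
  have hx' : ∀ q, Ox⁻¹.1 (l, 0) q
      = if q.1 = l then star (x q.2) else 0 := by
    intro q
    change star (Ox.1 q (l, 0)) = _
    rw [show q = (q.1, q.2) from rfl, hx q.1 q.2]
    split_ifs <;> simp
  have hξ' : ∀ q, Oxi⁻¹.1 (j, 0) q
      = if q.1 = j then star (ξ q.2) else 0 := by
    intro q
    change star (Oxi.1 q (j, 0)) = _
    rw [show q = (q.1, q.2) from rfl, hξ q.1 q.2]
    split_ifs <;> simp
  simp only [unprepMap, LinearMap.comp_apply, Matrix.mulVecLin_apply]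
  rw [hadamardUnitary_mulVec, featureMap_apply_of_true, featureMap_apply_of_false]
  simp only [flipUnitary_mulVec, Bool.not_true, Bool.not_false, characteristicMap_apply_of_false,
    characteristicMap_apply_of_true, hx', hξ', Fintype.sum_prod_type, Fintype.sum_bool]
  rw [Finset.sum_eq_single l (fun q _ hq => by simp [hq]) (by simp),
    Finset.sum_eq_single j (fun q _ hq => by simp [hq]) (by simp)]
  simp only [sector, pairState, hadamardMatrix, if_true, Finset.mul_sum, Bool.and_false,
    Bool.false_and, Bool.false_eq_true, if_false]
  rw [add_comm]
  congr 1 <;> refine Finset.sum_congr rfl fun y _ => ?_ <;> simp <;> ring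

theorem prepMap_reflect_unprepMap_sector (hx : PreparesAt Ox p.1 x) (hξ : PreparesAt Oxi p.2 ξ)
    (u : Bool × Fin (2 ^ n) → ℂ) :
    prepMap Ox.1 Oxi.1 ((reflectUnitary n p).1.mulVec
      (unprepMap Ox⁻¹.1 Oxi⁻¹.1 (sector p u)))
      = sector p fun q => 2 * (∑ q', star (pairState x ξ q') * u q') * pairState x ξ q - u q := by
  rw [reflectUnitary_mulVec, map_sub, map_smul, prepMap_unprepMap, ← sector_single_zero,
    prepMap_sector_single hx hξ, unprepMap_sector_apply hx hξ]
  funext y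
  simp only [sector, Pi.sub_apply, Pi.smul_apply, smul_eq_mul]
  split_ifs <;> simp

end ActiveMaps

/-! ### Circuits on counters and memory registers -/

section Circuit

variable {d k n a b : ℕ} {ι : Type}

/-- The state vector after performing a list of steps. -/
noncomputable def runSteps (Ox : Matrix.unitaryGroup (Fin d × Fin (2 ^ n)) ℂ)
    (Oxi : Matrix.unitaryGroup (Fin k × Fin (2 ^ n)) ℂ) (l : List (QStep d k n a))
    (ψ : BasisState d k n a → ℂ) : BasisState d k n a → ℂ :=
  l.foldl (fun ψ s => s.apply Ox Oxi ψ) ψ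

theorem runSteps_append (Ox : Matrix.unitaryGroup (Fin d × Fin (2 ^ n)) ℂ)
    (Oxi : Matrix.unitaryGroup (Fin k × Fin (2 ^ n)) ℂ) (l l' : List (QStep d k n a))
    (ψ : BasisState d k n a → ℂ) :
    runSteps Ox Oxi (l ++ l') ψ = runSteps Ox Oxi l' (runSteps Ox Oxi l ψ) :=
  List.foldl_append

theorem runSteps_cons (Ox : Matrix.unitaryGroup (Fin d × Fin (2 ^ n)) ℂ)
    (Oxi : Matrix.unitaryGroup (Fin k × Fin (2 ^ n)) ℂ) (s : QStep d k n a)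
    (l : List (QStep d k n a)) (ψ : BasisState d k n a → ℂ) :
    runSteps Ox Oxi (s :: l) ψ = runSteps Ox Oxi l (s.apply Ox Oxi ψ) := rfl

theorem runSteps_nil (Ox : Matrix.unitaryGroup (Fin d × Fin (2 ^ n)) ℂ)
    (Oxi : Matrix.unitaryGroup (Fin k × Fin (2 ^ n)) ℂ) (ψ : BasisState d k n a → ℂ) :
    runSteps Ox Oxi [] ψ = ψ := rfl

/-- Basis states of the work space: the active registers and, for every quantity to be estimated,
a counter register of `b + 1` qubits and a memory register for the rotated state. -/
abbrev WorkState (d k n b : ℕ) (ι : Type) : Type :=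
  ActiveState d k n × (ι → Fin (2 ^ (b + 1))) × (ι → Bool × Fin (2 ^ n))

/-- The work space as the state space of an algorithm, for a given encoding of the counters and
memory registers in `a` ancilla qubits. -/
def workEquiv (e : Fin (2 ^ a) ≃ (ι → Fin (2 ^ (b + 1))) × (ι → Bool × Fin (2 ^ n))) :
    BasisState d k n a ≃ WorkState d k n b ι where
  toFun x := ((x.1, x.2.1, x.2.2.1, x.2.2.2.1), e x.2.2.2.2)
  invFun x := (x.1.1, x.1.2.1, x.1.2.2.1, x.1.2.2.2, e.symm x.2)
  left_inv x := by simp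
  right_inv x := by simp

variable (n b ι) in
theorem exists_ancilla_equiv [Fintype ι] [DecidableEq ι] :
    ∃ a, Nonempty (Fin (2 ^ a) ≃ (ι → Fin (2 ^ (b + 1))) × (ι → Bool × Fin (2 ^ n))) := by
  refine ⟨(b + 1) * Fintype.card ι + (n + 1) * Fintype.card ι, ⟨Fintype.equivOfCardEq ?_⟩⟩
  simp only [Fintype.card_fin, Fintype.card_prod, Fintype.card_fun, Fintype.card_bool]
  rw [← pow_mul, pow_add, pow_succ' 2 n |>.symm, ← pow_mul]

/-- Apply a map, depending on the counters, to the active registers. -/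
def sliceMap (A : (ι → Fin (2 ^ (b + 1))) → (ActiveState d k n → ℂ) → (ActiveState d k n → ℂ))
    (Ψ : WorkState d k n b ι → ℂ) : WorkState d k n b ι → ℂ :=
  fun x => A x.2.1 (fun y => Ψ (y, x.2)) x.1

theorem sliceMap_sliceMap
    (A B : (ι → Fin (2 ^ (b + 1))) → (ActiveState d k n → ℂ) →ₗ[ℂ] (ActiveState d k n → ℂ))
    (Ψ : WorkState d k n b ι → ℂ) :
    sliceMap (fun s => A s) (sliceMap (fun s => B s) Ψ) = sliceMap (fun s => A s ∘ₗ B s) Ψ := rfl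

variable (e : Fin (2 ^ a) ≃ (ι → Fin (2 ^ (b + 1))) × (ι → Bool × Fin (2 ^ n)))

variable (Ox : Matrix.unitaryGroup (Fin d × Fin (2 ^ n)) ℂ)
  (Oxi : Matrix.unitaryGroup (Fin k × Fin (2 ^ n)) ℂ)

theorem feature_apply (inv : Bool) (Ψ : WorkState d k n b ι → ℂ) :
    (QStep.feature inv).apply Ox Oxi (Ψ ∘ workEquiv e)
      = sliceMap (fun _ => featureMap (if inv = true then Ox⁻¹ else Ox).1) Ψ ∘ workEquiv e := by
  funext ⟨c, l, j, y, w⟩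
  cases c <;> rfl

theorem characteristic_apply (inv : Bool) (Ψ : WorkState d k n b ι → ℂ) :
    (QStep.characteristic inv).apply Ox Oxi (Ψ ∘ workEquiv e)
      = sliceMap (fun _ => characteristicMap (if inv = true then Oxi⁻¹ else Oxi).1) Ψ
        ∘ workEquiv e := by
  funext ⟨c, l, j, y, w⟩
  cases c <;> rfl

section Load

variable [DecidableEq ι] [NeZero d] [NeZero k] (pos : ι → Fin d × Fin k)

/-- Exchange the active registers with the memory register selected by the counters. -/
def loadRegister (f : (ι → Fin (2 ^ (b + 1))) → Option ι) (x : WorkState d k n b ι) :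
    WorkState d k n b ι :=
  -- The index registers are transposed between `(0, 0)` and the fixed value `pos i`, so the memory
  -- need not store indices and the exchange is an involution.
  (f x.2.1).elim x fun i =>
    (((x.2.2 i).1, (Equiv.swap (0, 0) (pos i) (x.1.2.1, x.1.2.2.1)).1,
      (Equiv.swap (0, 0) (pos i) (x.1.2.1, x.1.2.2.1)).2, (x.2.2 i).2),
      x.2.1, Function.update x.2.2 i (x.1.1, x.1.2.2.2))

theorem loadRegister_involutive (f : (ι → Fin (2 ^ (b + 1))) → Option ι) :
    Function.Involutive (loadRegister (n := n) pos f) := by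
  rintro ⟨⟨c, l, j, y⟩, s, x⟩
  unfold loadRegister
  cases h : f s with
  | none => simp [h]
  | some i => simp [h]

end Load

variable [Fintype ι] [DecidableEq ι]

/-- A data-independent gate on the work space. -/
noncomputable def workGate (U : Matrix.unitaryGroup (WorkState d k n b ι) ℂ) : QStep d k n a :=
  .gate (reindexUnitary (workEquiv e) U)

/-- A data-independent gate on the active registers, controlled by the counters. -/
noncomputable def sliceGate
    (V : (ι → Fin (2 ^ (b + 1))) → Matrix.unitaryGroup (ActiveState d k n) ℂ) : QStep d k n a :=
  workGate e (blockUnitary fun s => V s.1)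

theorem workGate_apply (U : Matrix.unitaryGroup (WorkState d k n b ι) ℂ)
    (Ψ : WorkState d k n b ι → ℂ) :
    (workGate e U).apply Ox Oxi (Ψ ∘ workEquiv e) = U.1.mulVec Ψ ∘ workEquiv e :=
  reindexUnitary_mulVec _ _ _

theorem sliceGate_apply
    (V : (ι → Fin (2 ^ (b + 1))) → Matrix.unitaryGroup (ActiveState d k n) ℂ)
    (Ψ : WorkState d k n b ι → ℂ) :
    (sliceGate e V).apply Ox Oxi (Ψ ∘ workEquiv e)
      = sliceMap (fun s => (V s).1.mulVecLin) Ψ ∘ workEquiv e := by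
  rw [sliceGate, workGate_apply, blockUnitary_mulVec]
  rfl

/-- The steps performing `prepMap`. -/
noncomputable def prepSteps : List (QStep d k n a) :=
  [sliceGate e fun _ => hadamardUnitary d k n, .feature false,
    sliceGate e fun _ => flipUnitary d k n, .characteristic false]

/-- The steps performing `unprepMap`. -/
noncomputable def unprepSteps : List (QStep d k n a) :=
  [.characteristic true, sliceGate e fun _ => flipUnitary d k n, .feature true,
    sliceGate e fun _ => hadamardUnitary d k n]

theorem runSteps_prepSteps (Ψ : WorkState d k n b ι → ℂ) :
    runSteps Ox Oxi (prepSteps e) (Ψ ∘ workEquiv e)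
      = sliceMap (fun _ => prepMap Ox.1 Oxi.1) Ψ ∘ workEquiv e := by
  simp only [prepSteps, runSteps_cons, runSteps_nil, sliceGate_apply, feature_apply,
    characteristic_apply]
  rfl

theorem runSteps_unprepSteps (Ψ : WorkState d k n b ι → ℂ) :
    runSteps Ox Oxi (unprepSteps e) (Ψ ∘ workEquiv e)
      = sliceMap (fun _ => unprepMap Ox⁻¹.1 Oxi⁻¹.1) Ψ ∘ workEquiv e := by
  simp only [unprepSteps, runSteps_cons, runSteps_nil, sliceGate_apply, feature_apply,
    characteristic_apply]
  rfl

variable [NeZero d] [NeZero k] (pos : ι → Fin d × Fin k)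

/-- The gate exchanging the active registers with a memory register. -/
noncomputable def loadGate (f : (ι → Fin (2 ^ (b + 1))) → Option ι) : QStep d k n a :=
  workGate e (involutionUnitary _ (loadRegister_involutive pos f))

theorem loadGate_apply (f : (ι → Fin (2 ^ (b + 1))) → Option ι) (Ψ : WorkState d k n b ι → ℂ) :
    (loadGate e pos f).apply Ox Oxi (Ψ ∘ workEquiv e)
      = (Ψ ∘ loadRegister pos f) ∘ workEquiv e := by
  rw [loadGate, workGate_apply, involutionUnitary_mulVec]

/-- A superposition of counter values, with the memory registers in product states that depend on
the counters, and with the active registers zero. -/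
def prodState (G : (ι → Fin (2 ^ (b + 1))) → ℂ)
    (u : (ι → Fin (2 ^ (b + 1))) → ι → Bool × Fin (2 ^ n) → ℂ) : WorkState d k n b ι → ℂ :=
  fun x => if x.1 = (false, 0, 0, 0) then G x.2.1 * ∏ i, u x.2.1 i (x.2.2 i) else 0

theorem prodState_loadRegister_of_none {f : (ι → Fin (2 ^ (b + 1))) → Option ι}
    (G : (ι → Fin (2 ^ (b + 1))) → ℂ)
    (u : (ι → Fin (2 ^ (b + 1))) → ι → Bool × Fin (2 ^ n) → ℂ)
    (s : ι → Fin (2 ^ (b + 1))) (x : ι → Bool × Fin (2 ^ n)) (hf : f s = none) :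
    (fun y => (prodState (d := d) (k := k) G u ∘ loadRegister pos f) (y, s, x))
      = (G s * ∏ i, u s i (x i)) • Pi.single (false, 0, 0, 0) 1 := by
  funext y
  simp [prodState, loadRegister, hf, Pi.single_apply]

/-- After the exchange memory register `i` is blank and its state occupies the active registers in
the sector `pos i`, the only sector where the oracles' action has to be known. -/
theorem prodState_loadRegister_of_some {f : (ι → Fin (2 ^ (b + 1))) → Option ι}
    (G : (ι → Fin (2 ^ (b + 1))) → ℂ)
    (u : (ι → Fin (2 ^ (b + 1))) → ι → Bool × Fin (2 ^ n) → ℂ)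
    (s : ι → Fin (2 ^ (b + 1))) (x : ι → Bool × Fin (2 ^ n)) {i : ι} (hf : f s = some i) :
    (fun y => (prodState G u ∘ loadRegister pos f) (y, s, x))
      = (G s * if x i = (false, 0) then ∏ j ∈ Finset.univ.erase i, u s j (x j) else 0)
        • sector (pos i) (u s i) := by
  funext ⟨c, l, j, y⟩
  have hswap : Equiv.swap (0, 0) (pos i) (l, j) = (0, 0) ↔ (l, j) = pos i := by
    rw [Equiv.swap_apply_eq_iff, Equiv.swap_apply_left]
  have hprod : ∏ j, u s j (Function.update x i (c, y) j)
      = u s i (c, y) * ∏ j ∈ Finset.univ.erase i, u s j (x j) := by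
    rw [← Finset.mul_prod_erase _ _ (Finset.mem_univ i), Function.update_self]
    congr 1
    refine Finset.prod_congr rfl fun j hj => ?_
    rw [Function.update_of_ne (Finset.ne_of_mem_erase hj)]
  have hcond : ((x i).1, (Equiv.swap (0, 0) (pos i) (l, j)).1,
      (Equiv.swap (0, 0) (pos i) (l, j)).2, (x i).2) = (false, 0, 0, 0)
      ↔ x i = (false, 0) ∧ (l, j) = pos i := by
    rw [← hswap]
    simp only [Prod.ext_iff]
    tauto
  simp only [Function.comp_apply, prodState, loadRegister, hf, Option.elim_some, hcond, hprod,
    Pi.smul_apply, sector, smul_eq_mul]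
  by_cases h1 : x i = (false, 0) <;> by_cases h2 : (l, j) = pos i <;> simp [h1, h2]
  ring

/-- A controlled operation on the selected memory register, performed in the active registers. -/
theorem sliceMap_loadRegister {f : (ι → Fin (2 ^ (b + 1))) → Option ι}
    (A : (ι → Fin (2 ^ (b + 1))) → (ActiveState d k n → ℂ) →ₗ[ℂ] (ActiveState d k n → ℂ))
    (G : (ι → Fin (2 ^ (b + 1))) → ℂ)
    (u u' : (ι → Fin (2 ^ (b + 1))) → ι → Bool × Fin (2 ^ n) → ℂ)
    (hnone : ∀ s, f s = none → (∀ v, A s v = v) ∧ u' s = u s)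
    (hsome : ∀ s i, f s = some i → A s (sector (pos i) (u s i)) = sector (pos i) (u' s i) ∧
      ∀ j, j ≠ i → u' s j = u s j) :
    sliceMap (fun s => A s) (prodState G u ∘ loadRegister pos f) ∘ loadRegister pos f
      = prodState G u' := by
  suffices h : sliceMap (fun s => A s) (prodState G u ∘ loadRegister pos f)
      = prodState G u' ∘ loadRegister pos f by
    rw [h, Function.comp_assoc, (loadRegister_involutive pos f).comp_self, Function.comp_id]
  funext ⟨y, s, x⟩
  change A s (fun y => (prodState G u ∘ loadRegister pos f) (y, s, x)) y
    = (fun y => (prodState G u' ∘ loadRegister pos f) (y, s, x)) y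
  cases hf : f s with
  | none =>
    rw [prodState_loadRegister_of_none pos G u s x hf,
      prodState_loadRegister_of_none pos G u' s x hf, (hnone s hf).1, (hnone s hf).2]
  | some i =>
    rw [prodState_loadRegister_of_some pos G u s x hf,
      prodState_loadRegister_of_some pos G u' s x hf, map_smul, (hsome s i hf).1]
    have : ∏ j ∈ Finset.univ.erase i, u' s j (x j) = ∏ j ∈ Finset.univ.erase i, u s j (x j) :=
      Finset.prod_congr rfl fun j hj => by rw [(hsome s i hf).2 j (Finset.ne_of_mem_erase hj)]
    rw [this]

/-- Prepare the memory register `i`. -/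
noncomputable def prepRegisterSteps (i : ι) : List (QStep d k n a) :=
  loadGate e pos (fun _ => some i) :: (prepSteps e ++ [loadGate e pos fun _ => some i])

/-- One reflection step on the selected memory register, together with a NOT gate on its control
qubit before or after, depending on the sign of the counter. -/
noncomputable def roundSteps (f : (ι → Fin (2 ^ (b + 1))) → Option ι) : List (QStep d k n a) :=
  -- The oracles are queried in every branch, since the counters control only data-independent
  -- gates. In an idle branch those gates are trivial and preparation undoes unpreparation.
  [loadGate e pos f, sliceGate e fun s => (f s).elim 1 fun i =>
      if 0 ≤ signedValue b (s i) then 1 else flipUnitary d k n]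
    ++ unprepSteps e ++ [sliceGate e fun s => (f s).elim 1 fun i => reflectUnitary n (pos i)]
    ++ prepSteps e ++ [sliceGate e fun s => (f s).elim 1 fun i =>
      if 0 ≤ signedValue b (s i) then flipUnitary d k n else 1, loadGate e pos f]

variable {Ox Oxi} {x : ι → Fin (2 ^ n) → ℂ} {ξ : ι → Fin (2 ^ n) → ℂ}

theorem runSteps_prepRegisterSteps (hx : ∀ i, PreparesAt Ox (pos i).1 (x i))
    (hξ : ∀ i, PreparesAt Oxi (pos i).2 (ξ i)) (G : (ι → Fin (2 ^ (b + 1))) → ℂ)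
    (u : ι → Bool × Fin (2 ^ n) → ℂ) (i : ι) (hu : u i = Pi.single (false, 0) 1) :
    runSteps Ox Oxi (prepRegisterSteps e pos i) (prodState G (fun _ => u) ∘ workEquiv e)
      = prodState G (fun _ => Function.update u i (pairState (x i) (ξ i))) ∘ workEquiv e := by
  rw [prepRegisterSteps, runSteps_cons, runSteps_append, loadGate_apply, runSteps_prepSteps,
    runSteps_cons, runSteps_nil, loadGate_apply]
  congr 1
  refine sliceMap_loadRegister pos (fun _ => prepMap Ox.1 Oxi.1) G _ _ (by simp) ?_
  rintro s j hj
  obtain rfl : i = j := Option.some.inj hj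
  refine ⟨?_, fun j hj => Function.update_of_ne hj _ _⟩
  rw [hu, prepMap_sector_single (hx i) (hξ i), Function.update_self]

theorem runSteps_flatMap_prepRegisterSteps (hx : ∀ i, PreparesAt Ox (pos i).1 (x i))
    (hξ : ∀ i, PreparesAt Oxi (pos i).2 (ξ i)) (G : (ι → Fin (2 ^ (b + 1))) → ℂ)
    (l : List ι) (hl : l.Nodup) (u : ι → Bool × Fin (2 ^ n) → ℂ)
    (hu : ∀ i ∈ l, u i = Pi.single (false, 0) 1) :
    runSteps Ox Oxi (l.flatMap (prepRegisterSteps e pos)) (prodState G (fun _ => u) ∘ workEquiv e)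
      = prodState G (fun _ i => if i ∈ l then pairState (x i) (ξ i) else u i) ∘ workEquiv e := by
  induction l generalizing u with
  | nil => simp [runSteps_nil]
  | cons i l ih =>
    rw [List.nodup_cons] at hl
    rw [List.flatMap_cons, runSteps_append,
      runSteps_prepRegisterSteps e pos hx hξ G u i (hu i (by simp)), ih hl.2]
    · congr 2
      funext _ j
      by_cases h1 : j = i
      · subst h1; simp [hl.1]
      · simp [h1]
    · intro j hj
      rw [Function.update_of_ne (by rintro rfl; exact hl.1 hj)]
      exact hu j (by simp [hj])

/-- The rotation angle reached after `m` rounds, with the sign of `z`. -/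
def signedSteps (z : ℤ) (m : ℕ) : ℤ := if 0 ≤ z then m else -m

theorem runSteps_roundSteps (hx : ∀ i, PreparesAt Ox (pos i).1 (x i))
    (hξ : ∀ i, PreparesAt Oxi (pos i).2 (ξ i)) (G : (ι → Fin (2 ^ (b + 1))) → ℂ)
    (α : ι → ℤ → Bool × Fin (2 ^ n) → ℂ)
    (hflip : ∀ i z q, α i z (!q.1, q.2) = α i (1 - z) q)
    (hrefl : ∀ i z q, 2 * (∑ q', star (pairState (x i) (ξ i) q') * α i z q')
      * pairState (x i) (ξ i) q - α i z q = α i (-z) q)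
    (m : (ι → Fin (2 ^ (b + 1))) → ι → ℕ) (f : (ι → Fin (2 ^ (b + 1))) → Option ι) :
    runSteps Ox Oxi (roundSteps e pos f) (prodState G
        (fun s i => α i (signedSteps (signedValue b (s i)) (m s i))) ∘ workEquiv e)
      = prodState G (fun s i => α i (signedSteps (signedValue b (s i))
        (m s i + if f s = some i then 1 else 0))) ∘ workEquiv e := by
  simp only [roundSteps, runSteps_append, runSteps_cons, runSteps_nil, loadGate_apply,
    sliceGate_apply, runSteps_prepSteps, runSteps_unprepSteps]
  congr 1
  simp only [sliceMap_sliceMap]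
  refine sliceMap_loadRegister pos _ G _ _ ?_ ?_
  · intro s hs
    refine ⟨fun v => ?_, by simp [hs]⟩
    simpa [hs] using prepMap_unprepMap Ox Oxi v
  · intro s i hs
    have hflip' : ∀ z, (flipUnitary d k n).1.mulVec (sector (pos i) (α i z))
        = sector (pos i) (α i (1 - z)) := by
      intro z
      rw [flipUnitary_sector]
      congr 1
      funext q
      exact hflip i z q
    have hrefl' : ∀ z, prepMap Ox.1 Oxi.1 ((reflectUnitary n (pos i)).1.mulVec
        (unprepMap Ox⁻¹.1 Oxi⁻¹.1 (sector (pos i) (α i z)))) = sector (pos i) (α i (-z)) := by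
      intro z
      rw [prepMap_reflect_unprepMap_sector (hx i) (hξ i)]
      congr 1
      funext q
      exact hrefl i z q
    constructor
    · simp only [hs, Option.elim_some, LinearMap.comp_apply, Matrix.mulVecLin_apply, if_true]
      -- Reflection then flip sends $z$ to $-z$ to $1+z$; flip then reflection sends $z$ to $1-z$ to
      -- $z-1$.
      by_cases hz : 0 ≤ signedValue b (s i)
      · simp only [hz, if_true, signedSteps, OneMemClass.coe_one, Matrix.one_mulVec]
        rw [hrefl', hflip']
        congr 2
        push_cast
        ring
      · simp only [hz, if_false, signedSteps, OneMemClass.coe_one, Matrix.one_mulVec]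
        rw [hflip', hrefl']
        congr 2
        push_cast
        ring
    · intro j hj
      have : f s ≠ some j := by
        rw [hs]
        exact fun h => hj (Option.some.inj h).symm
      simp [this]

theorem runSteps_flatMap_roundSteps (hx : ∀ i, PreparesAt Ox (pos i).1 (x i))
    (hξ : ∀ i, PreparesAt Oxi (pos i).2 (ξ i)) (G : (ι → Fin (2 ^ (b + 1))) → ℂ)
    (α : ι → ℤ → Bool × Fin (2 ^ n) → ℂ)
    (hflip : ∀ i z q, α i z (!q.1, q.2) = α i (1 - z) q)
    (hrefl : ∀ i z q, 2 * (∑ q', star (pairState (x i) (ξ i) q') * α i z q')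
      * pairState (x i) (ξ i) q - α i z q = α i (-z) q)
    (fs : List ((ι → Fin (2 ^ (b + 1))) → Option ι)) (m : (ι → Fin (2 ^ (b + 1))) → ι → ℕ) :
    runSteps Ox Oxi (fs.flatMap (roundSteps e pos)) (prodState G
        (fun s i => α i (signedSteps (signedValue b (s i)) (m s i))) ∘ workEquiv e)
      = prodState G (fun s i => α i (signedSteps (signedValue b (s i))
        (m s i + (fs.map fun f => f s).count (some i)))) ∘ workEquiv e := by
  induction fs generalizing m with
  | nil => simp [runSteps_nil]
  | cons f fs ih =>
    rw [List.flatMap_cons, runSteps_append,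
      runSteps_roundSteps e pos hx hξ G α hflip hrefl m f, ih]
    congr 2
    funext s i
    rw [List.map_cons, List.count_cons]
    congr 2
    simp only [beq_iff_eq]
    ring

end Circuit

/-! ### Scheduling the rotations -/

/-- A schedule of `L` rounds in which every register `i` is served `w s i` times, for all `s` of
total demand at most `L`. -/
theorem exists_schedule {σ ι : Type*} [Fintype ι] [DecidableEq ι] (w : σ → ι → ℕ) (L : ℕ) :
    ∃ fs : List (σ → Option ι), fs.length = L ∧
      ∀ s, ∑ i, w s i ≤ L → ∀ i, (fs.map fun f => f s).count (some i) = w s i := by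
  have h : ∀ s, ∃ l : List (Option ι), l.length = L ∧
      (∑ i, w s i ≤ L → ∀ i, l.count (some i) = w s i) := by
    intro s
    by_cases hs : ∑ i, w s i ≤ L
    -- The demands in any order, padded with idle rounds to length `L`; all branches must have
    -- equally many rounds.
    · let m : Multiset (Option ι) := ∑ i, Multiset.replicate (w s i) (some i)
        + Multiset.replicate (L - ∑ i, w s i) none
      refine ⟨m.toList, ?_, fun _ i => ?_⟩
      · simp only [m, Multiset.length_toList, Multiset.card_add, Multiset.card_sum,
          Multiset.card_replicate]
        omega
      · have hm : m.count (some i) = w s i := by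
          simp [m, Multiset.count_sum', Multiset.count_replicate]
        rw [← Multiset.coe_toList m, Multiset.coe_count] at hm
        convert hm using 2
        exact lawful_beq_subsingleton _ _
    · exact ⟨List.replicate L none, by simp, fun h => absurd h hs⟩
  choose l hl hc using h
  refine ⟨List.ofFn fun (t : Fin L) s => (l s).get (t.cast (hl s).symm), by simp, fun s hs i => ?_⟩
  rw [← hc s hs i]
  congr 1
  refine List.ext_get (by simp [hl]) fun t h1 h2 => ?_
  simp

/-! ### Simultaneous estimation of inner products -/

section Algorithm

open scoped Kronecker

variable {d k n a b : ℕ} {ι : Type} [Fintype ι] [DecidableEq ι]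
  (e : Fin (2 ^ a) ≃ (ι → Fin (2 ^ (b + 1))) × (ι → Bool × Fin (2 ^ n)))

/-- The Fourier transform on the counters, as a unitary on the work space. -/
noncomputable def counterDFT (d k n b : ℕ) (ι : Type) [Fintype ι] [DecidableEq ι] :
    Matrix.unitaryGroup (WorkState d k n b ι) ℂ :=
  ⟨(1 : Matrix (ActiveState d k n) (ActiveState d k n) ℂ) ⊗ₖ ((signedDFT b).piPow ι ⊗ₖ
      (1 : Matrix (ι → Bool × Fin (2 ^ n)) (ι → Bool × Fin (2 ^ n)) ℂ)),
    Matrix.kronecker_mem_unitary (one_mem _) (Matrix.kronecker_mem_unitary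
      (Matrix.piPow_mem_unitaryGroup (signedDFT_mem_unitaryGroup b)) (one_mem _))⟩

theorem counterDFT_mulVec (Ψ : WorkState d k n b ι → ℂ) (x : WorkState d k n b ι) :
    (counterDFT d k n b ι).1.mulVec Ψ x
      = ∑ s, (signedDFT b).piPow ι x.2.1 s * Ψ (x.1, s, x.2.2) := by
  rw [Matrix.mulVec, dotProduct, Fintype.sum_prod_type, Finset.sum_eq_single x.1,
    Fintype.sum_prod_type]
  · refine Finset.sum_congr rfl fun s _ => ?_
    rw [Finset.sum_eq_single x.2.2]
    · simp [counterDFT]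
    · intro y _ hy
      simp [counterDFT, Matrix.one_apply_ne hy.symm]
    · simp
  · intro y _ hy
    simp [counterDFT, Matrix.one_apply_ne hy.symm]
  · simp

theorem sum_time_prepSteps (T Txi : ℝ) :
    ((prepSteps e : List (QStep d k n a)).map (QStep.time T Txi)).sum = T + Txi := by
  simp [prepSteps, QStep.time, sliceGate, workGate]

theorem sum_time_unprepSteps (T Txi : ℝ) :
    ((unprepSteps e : List (QStep d k n a)).map (QStep.time T Txi)).sum = T + Txi := by
  simp [unprepSteps, QStep.time, sliceGate, workGate, add_comm]

variable [NeZero d] [NeZero k] (pos : ι → Fin d × Fin k)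

theorem sum_norm_sq_prodState_single (G : (ι → Fin (2 ^ (b + 1))) → ℂ)
    (hG : ∑ s, ‖G s‖ ^ 2 = 1) :
    ∑ x, ‖prodState (d := d) (k := k) (n := n) G (fun _ _ => Pi.single (false, 0) 1) x‖ ^ 2
      = 1 := by
  have hone : ∑ x : ι → Bool × Fin (2 ^ n),
      ∏ i, ‖(Pi.single (false, 0) 1 : Bool × Fin (2 ^ n) → ℂ) (x i)‖ ^ 2 = 1 := by
    have h := Finset.prod_univ_sum (fun _ : ι => Finset.univ)
      (fun _ y => ‖(Pi.single (false, 0) 1 : Bool × Fin (2 ^ n) → ℂ) y‖ ^ 2)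
    rw [Fintype.piFinset_univ] at h
    rw [← h]
    refine Finset.prod_eq_one fun i _ => ?_
    rw [Finset.sum_eq_single (false, 0) (fun y _ hy => by simp [Pi.single_eq_of_ne hy]) (by simp)]
    simp
  rw [Fintype.sum_prod_type, Finset.sum_eq_single (false, 0, 0, 0)
    (fun y _ hy => by simp [prodState, hy]) (by simp), Fintype.sum_prod_type]
  simp only [prodState, if_true, norm_mul, mul_pow, norm_prod, ← Finset.prod_pow,
    ← Finset.mul_sum, hone, mul_one, hG]

theorem sum_time_prepRegisterSteps (T Txi : ℝ) (i : ι) :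
    ((prepRegisterSteps e pos i).map (QStep.time T Txi)).sum = T + Txi := by
  simp [prepRegisterSteps, sum_time_prepSteps, loadGate, workGate, QStep.time]

theorem sum_time_roundSteps (T Txi : ℝ) (f : (ι → Fin (2 ^ (b + 1))) → Option ι) :
    ((roundSteps e pos f).map (QStep.time T Txi)).sum = 2 * (T + Txi) := by
  simp only [roundSteps, List.map_append, List.sum_append, sum_time_prepSteps,
    sum_time_unprepSteps]
  simp [loadGate, workGate, sliceGate, QStep.time]
  ring

theorem List.sum_map_flatMap_of_const {α β : Type*} (l : List α) (f : α → List β) (t : β → ℝ)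
    (c : ℝ) (h : ∀ x, ((f x).map t).sum = c) : ((l.flatMap f).map t).sum = l.length * c := by
  induction l with
  | nil => simp
  | cons x l ih =>
    rw [List.flatMap_cons, List.map_append, List.sum_append, ih, h, List.length_cons]
    push_cast
    ring

/-- The counters are brought into the superposition `G`, the memory registers are rotated by the
angles the counters prescribe, and the counters are Fourier transformed. -/
theorem exists_rotation_steps (L : ℕ) (G : (ι → Fin (2 ^ (b + 1))) → ℂ)
    (hG : ∑ s, ‖G s‖ ^ 2 = 1)
    (hGL : ∀ s, G s ≠ 0 → ∑ i, (signedValue b (s i)).natAbs ≤ L) :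
    ∃ steps : List (QStep d k n a),
      (∀ T Txi : ℝ, (steps.map (QStep.time T Txi)).sum
        = (2 * L + Fintype.card ι) * (T + Txi)) ∧
      ∀ (Ox : Matrix.unitaryGroup (Fin d × Fin (2 ^ n)) ℂ)
        (Oxi : Matrix.unitaryGroup (Fin k × Fin (2 ^ n)) ℂ) (x ξ : ι → Fin (2 ^ n) → ℂ),
        (∀ i, PreparesAt Ox (pos i).1 (x i)) → (∀ i, PreparesAt Oxi (pos i).2 (ξ i)) →
        ∀ α : ι → ℤ → Bool × Fin (2 ^ n) → ℂ, (∀ i, α i 0 = pairState (x i) (ξ i)) →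
        (∀ i z q, α i z (!q.1, q.2) = α i (1 - z) q) →
        (∀ i z q, 2 * (∑ q', star (pairState (x i) (ξ i) q') * α i z q')
          * pairState (x i) (ξ i) q - α i z q = α i (-z) q) →
        ∀ q m, runSteps Ox Oxi steps (Pi.single (false, 0, 0, 0, 0) 1)
          ((workEquiv e).symm ((false, 0, 0, 0), q, m))
          = ∑ s, (signedDFT b).piPow ι q s * (G s * ∏ i, α i (signedValue b (s i)) (m i)) := by
  obtain ⟨U, hU⟩ := exists_unitary_mulVec_single (false, 0, 0, 0, 0)
    (prodState (d := d) (k := k) G (fun _ _ => Pi.single (false, 0) 1) ∘ workEquiv e) (by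
      rw [← sum_norm_sq_prodState_single (d := d) (k := k) (n := n) G hG]
      exact Equiv.sum_comp (workEquiv e) (fun x => ‖prodState G _ x‖ ^ 2))
  obtain ⟨fs, hfs, hcount⟩ := exists_schedule
    (fun (s : ι → Fin (2 ^ (b + 1))) i => (signedValue b (s i)).natAbs) L
  refine ⟨.gate U :: (Finset.univ.toList.flatMap (prepRegisterSteps e pos)
    ++ fs.flatMap (roundSteps e pos) ++ [workGate e (counterDFT d k n b ι)]), ?_, ?_⟩
  · intro T Txi
    rw [List.map_cons, List.map_append, List.map_append, List.sum_cons, List.sum_append,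
      List.sum_append, List.sum_map_flatMap_of_const _ _ _ _ (sum_time_prepRegisterSteps e pos T Txi),
      List.sum_map_flatMap_of_const _ _ _ _ (sum_time_roundSteps e pos T Txi), hfs]
    simp [workGate, QStep.time]
    ring
  · intro Ox Oxi x ξ hx hξ α hα0 hflip hrefl q m
    rw [runSteps_cons, runSteps_append, runSteps_append]
    change runSteps Ox Oxi _ (runSteps Ox Oxi _ (runSteps Ox Oxi _ (U.1.mulVec _))) _ = _
    rw [hU, runSteps_flatMap_prepRegisterSteps e pos hx hξ G _ (Finset.nodup_toList _) _
      (fun _ _ => rfl)]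
    have hinit : (fun (_ : ι → Fin (2 ^ (b + 1))) i => if i ∈ Finset.univ.toList then
        pairState (x i) (ξ i) else Pi.single (false, 0) 1)
        = fun s i => α i (signedSteps (signedValue b (s i)) 0) := by
      funext s i
      simp [signedSteps, hα0]
    rw [hinit, runSteps_flatMap_roundSteps e pos hx hξ G α hflip hrefl fs (fun _ _ => 0),
      runSteps_cons, runSteps_nil, workGate_apply, Function.comp_apply, Equiv.apply_symm_apply,
      counterDFT_mulVec]
    refine Finset.sum_congr rfl fun s _ => ?_
    simp only [prodState, if_true]
    by_cases hs : G s = 0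
    · simp [hs]
    · congr 2
      refine Finset.prod_congr rfl fun i _ => ?_
      rw [hcount s (hGL s hs) i, zero_add]
      congr 1
      unfold signedSteps
      split_ifs <;> omega

theorem sum_norm_sq_pairState (x ξ : Fin (2 ^ n) → ℂ) (hx : ∑ y, ‖x y‖ ^ 2 = 1)
    (hξ : ∑ y, ‖ξ y‖ ^ 2 = 1) : ∑ q, ‖pairState x ξ q‖ ^ 2 = 1 := by
  have h2 : Real.sqrt 2 ^ 2 = 2 := Real.sq_sqrt zero_le_two
  simp only [pairState, Fintype.sum_prod_type, Fintype.sum_bool, if_true, Bool.false_eq_true,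
    if_false, norm_div, div_pow, Complex.norm_real, Real.norm_eq_abs, sq_abs, h2]
  rw [← Finset.sum_div, ← Finset.sum_div, hx, hξ]
  norm_num

/-- The two control values contribute half the inner product and half its conjugate, which agree as
it is real. -/
theorem sum_star_pairState_mul (x ξ : Fin (2 ^ n) → ℂ) (r : ℝ)
    (hr : ∑ y, star (ξ y) * x y = (r : ℂ)) :
    ∑ q : Bool × Fin (2 ^ n), star (pairState x ξ q) * pairState x ξ (!q.1, q.2) = (r : ℂ) := by
  have h2 : ((Real.sqrt 2 : ℝ) : ℂ) * (Real.sqrt 2 : ℝ) = 2 := by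
    rw [← Complex.ofReal_mul, Real.mul_self_sqrt zero_le_two]; norm_num
  have hr' : ∑ y, star (x y) * ξ y = (r : ℂ) := by
    have := congrArg star hr
    rw [star_sum, RCLike.star_def, Complex.conj_ofReal] at this
    rw [← this]
    refine Finset.sum_congr rfl fun y _ => ?_
    simp [mul_comm]
  simp only [pairState, Fintype.sum_prod_type, Fintype.sum_bool, if_true, Bool.false_eq_true,
    if_false, Bool.not_true, Bool.not_false, star_div₀, RCLike.star_def, Complex.conj_ofReal,
    div_mul_div_comm, h2]
  simp only [RCLike.star_def] at hr hr'
  rw [← Finset.sum_div, ← Finset.sum_div, hr, hr']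
  ring

/-- Estimation of many real inner products `⟪ξ i, x i⟫` to precision `1 / n₀`, simultaneously
and without logarithmic overhead. -/
theorem exists_inner_product_estimation (pos : ι → Fin d × Fin k) (n : ℕ) {κ : ℝ} (hκ : 0 < κ)
    (hκ1 : κ < 1) (n₀ M L : ℕ) (hn₀ : 1 ≤ n₀) (hM : 1 ≤ M) (hcard : Fintype.card ι ≤ M)
    (hL : (M : ℝ) * (80 * n₀) ≤ κ ^ 2 * L) :
    ∃ (a : ℕ) (steps : List (QStep d k n a)) (est : BasisState d k n a → ι → ℝ),
      (∀ T Txi : ℝ, (steps.map (QStep.time T Txi)).sum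
        = (2 * L + Fintype.card ι) * (T + Txi)) ∧
      ∀ (Ox : Matrix.unitaryGroup (Fin d × Fin (2 ^ n)) ℂ)
        (Oxi : Matrix.unitaryGroup (Fin k × Fin (2 ^ n)) ℂ) (x ξ : ι → Fin (2 ^ n) → ℂ)
        (r : ι → ℝ),
        (∀ i, PreparesAt Ox (pos i).1 (x i)) → (∀ i, PreparesAt Oxi (pos i).2 (ξ i)) →
        (∀ i, ∑ y, ‖x i y‖ ^ 2 = 1) → (∀ i, ∑ y, ‖ξ i y‖ ^ 2 = 1) →
        (∀ i, ∑ y, star (ξ i y) * x i y = (r i : ℂ)) →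
        ∀ good : Finset (BasisState d k n a),
          (∀ c, (∀ i, |est c i - r i| ≤ 1 / n₀) → c ∈ good) →
        1 - 3 * κ ≤ ∑ c ∈ good,
          ‖runSteps Ox Oxi steps (Pi.single (false, 0, 0, 0, 0) 1) c‖ ^ 2 := by
  have hMpos : (0 : ℝ) < M := by exact_mod_cast hM
  have hn₀pos : (0 : ℝ) < n₀ := by exact_mod_cast hn₀
  have hLpos : 0 < L := by
    rw [← Nat.cast_pos (α := ℝ)]
    have : 0 < κ ^ 2 * L := lt_of_lt_of_le (by positivity) hL
    exact pos_of_mul_pos_right this (by positivity)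
  have hcard' : (Fintype.card ι : ℝ) ≤ M := by exact_mod_cast hcard
  -- With this tolerance each register fails with probability at most $2\tau^2 = \kappa/M$. Only the
  -- counter size `b` depends on it, not the bound $80 n_0$ on the mean.
  obtain ⟨b, g, hg1, hgE, hgτ⟩ := exists_window n₀ hn₀ (Real.sqrt (κ / (2 * M))) (by positivity)
  obtain ⟨a, ⟨e⟩⟩ := exists_ancilla_equiv n b ι
  have hEL : Fintype.card ι * (80 * (n₀ : ℝ)) ≤ κ ^ 2 * L :=
    le_trans (by gcongr) hL
  have habs : ∀ s, (((signedValue b s).natAbs : ℕ) : ℝ) = |(signedValue b s : ℝ)| := by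
    intro s
    rw [Nat.cast_natAbs, Int.cast_abs]
  set w : Fin (2 ^ (b + 1)) → ℕ := fun s => (signedValue b s).natAbs with hw
  have hgE' : ∑ s, w s * g s ^ 2 ≤ 80 * (n₀ : ℝ) := by simpa only [hw, habs] using hgE
  obtain ⟨hP0, hP1⟩ := sum_prod_budget_bounds (ι := ι) (fun s => g s ^ 2) (fun _ => sq_nonneg _)
    hg1 w hgE' L hLpos hEL
  set P := ∑ s ∈ (budget w L : Finset (ι → _)), ∏ i, g (s i) ^ 2 with hP
  have hPpos : 0 < P := by nlinarith
  -- The product window cut off at the budget and renormalised.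
  let G : (ι → Fin (2 ^ (b + 1))) → ℂ := fun s =>
    if s ∈ budget w L then ((∏ i, g (s i)) / Real.sqrt P : ℝ) else 0
  have hGsum : ∑ s, ‖G s‖ ^ 2 = 1 := by
    have : ∀ s, ‖G s‖ ^ 2 = if s ∈ budget w L then (∏ i, g (s i) ^ 2) / P else 0 := by
      intro s
      simp only [G]
      split_ifs
      · rw [Complex.norm_real, Real.norm_eq_abs, sq_abs, div_pow, Real.sq_sqrt hPpos.le,
          Finset.prod_pow]
      · simp
    simp only [this, Finset.sum_ite_mem, Finset.univ_inter]
    rw [← Finset.sum_div, ← hP, div_self hPpos.ne']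
  obtain ⟨steps, htime, hsteps⟩ := exists_rotation_steps (d := d) (k := k) e pos L G hGsum (by
    intro s hs
    by_contra h
    exact hs (if_neg (by simpa [budget] using h)))
  refine ⟨a, steps, fun c i => Real.cos (2 * Real.pi * (((workEquiv e c).2.1 i : ℕ) : ℝ)
    / 2 ^ (b + 1)), htime, ?_⟩
  intro Ox Oxi x ξ r hx hξ hx1 hξ1 hr good hgoodset
  have hwalk := fun i => exists_walk (pairState (x i) (ξ i))
    (sum_norm_sq_pairState _ _ (hx1 i) (hξ1 i)) (r i) (sum_star_pairState_mul _ _ _ (hr i))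
  choose α hα0 hαnorm hαflip hαrefl A B hAB hαAB using hwalk
  have hrun := hsteps Ox Oxi x ξ hx hξ α hα0 hαflip hαrefl
  let good' : ι → Finset (Fin (2 ^ (b + 1))) := fun i =>
    {q | |Real.cos (2 * Real.pi * q / 2 ^ (b + 1)) - r i| ≤ 1 / n₀}
  let h : ι → Fin (2 ^ (b + 1)) → Bool × Fin (2 ^ n) → ℂ := fun i s y =>
    g s * α i (signedValue b s) y
  have hsumh : ∀ i s, ∑ y, ‖h i s y‖ ^ 2 = g s ^ 2 := by
    intro i s
    simp only [h, norm_mul, mul_pow, ← Finset.mul_sum, hαnorm, mul_one, Complex.norm_real,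
      Real.norm_eq_abs, sq_abs]
  have hh1 : ∀ i, ∑ s, ∑ y, ‖h i s y‖ ^ 2 = 1 := fun i => by simp only [hsumh, hg1]
  have hrabs : ∀ i, Real.cos (Real.arccos (r i)) = r i := by
    intro i
    have h1 : ‖(r i : ℂ)‖ ≤ 1 := by
      rw [← hr i, ← EuclideanSpace.inner_toLp_eq_sum]
      refine (norm_inner_le_norm _ _).trans ?_
      have e1 : ‖(WithLp.toLp 2 (ξ i) : EuclideanSpace ℂ _)‖ = 1 := by
        rw [← sq_eq_sq₀ (norm_nonneg _) zero_le_one, EuclideanSpace.norm_toLp_sq, hξ1, one_pow]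
      have e2 : ‖(WithLp.toLp 2 (x i) : EuclideanSpace ℂ _)‖ = 1 := by
        rw [← sq_eq_sq₀ (norm_nonneg _) zero_le_one, EuclideanSpace.norm_toLp_sq, hx1, one_pow]
      rw [e1, e2, one_mul]
    rw [Complex.norm_real, Real.norm_eq_abs, abs_le] at h1
    exact Real.cos_arccos h1.1 h1.2
  have hgood : ∀ i, 1 - κ / M
      ≤ ∑ q ∈ good' i, ∑ y, ‖∑ s, signedDFT b q s * h i s y‖ ^ 2 := by
    intro i
    have hbad := sum_bad_signedDFT_le b g hgτ (α i) (A i) (B i) (hAB i) (hαAB i) (good' i)ᶜ (by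
      intro q hq
      rw [hrabs]
      simpa [good'] using hq)
    rw [Real.sq_sqrt (by positivity)] at hbad
    have htot : ∑ q, ∑ y, ‖∑ s, signedDFT b q s * h i s y‖ ^ 2 = 1 := by
      rw [Finset.sum_comm, ← hh1 i]
      conv_rhs => rw [Finset.sum_comm]
      exact Finset.sum_congr rfl fun y _ => Matrix.sum_norm_sq_mulVec_of_mem_unitaryGroup
        (signedDFT_mem_unitaryGroup b) _
    rw [← Finset.sum_add_sum_compl (good' i)] at htot
    have : 2 * (κ / (2 * M)) = κ / M := by field_simp
    rw [this] at hbad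
    simp only [h] at htot ⊢
    linarith
  have hmain := one_sub_le_sum_good_budget (signedDFT_mem_unitaryGroup b) h hh1 w
    (fun i => by simpa only [← Finset.mul_sum, hsumh] using hgE') L hLpos hEL hκ hκ1 good'
    (τ := κ / M) (by rw [mul_div_assoc', div_le_iff₀ hMpos]; nlinarith)
    (by rw [div_le_one hMpos]; exact hκ1.le.trans (by exact_mod_cast hM)) hgood
  refine hmain.trans ?_
  have hval : ∀ q m, ‖∑ s ∈ budget w L, (signedDFT b).piPow ι q s * ∏ i, h i (s i) (m i)‖ ^ 2
      ≤ ‖runSteps Ox Oxi steps (Pi.single (false, 0, 0, 0, 0) 1)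
          ((workEquiv e).symm ((false, 0, 0, 0), q, m))‖ ^ 2 := by
    intro q m
    have hfac : ∑ s, (signedDFT b).piPow ι q s * (G s * ∏ i, α i (signedValue b (s i)) (m i))
        = (∑ s ∈ budget w L, (signedDFT b).piPow ι q s * ∏ i, h i (s i) (m i))
          / (Real.sqrt P : ℝ) := by
      rw [Finset.sum_div, ← Finset.univ_inter (budget w L), ← Finset.sum_ite_mem]
      refine Finset.sum_congr rfl fun s _ => ?_
      simp only [G]
      split_ifs
      · simp only [h, Finset.prod_mul_distrib]
        push_cast
        ring
      · simp
    rw [hrun, hfac, norm_div, div_pow, Complex.norm_real, Real.norm_eq_abs, sq_abs,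
      Real.sq_sqrt hPpos.le, le_div_iff₀ hPpos]
    exact mul_le_of_le_one_right (sq_nonneg _) hP1
  refine (Finset.sum_le_sum fun q _ => Finset.sum_le_sum fun m _ => hval q m).trans ?_
  rw [← Finset.sum_product']
  have hinj : Function.Injective (fun qm : (ι → Fin (2 ^ (b + 1))) × (ι → Bool × Fin (2 ^ n)) =>
      (workEquiv (d := d) (k := k) e).symm ((false, 0, 0, 0), qm)) := by
    intro u v huv
    simpa using huv
  refine (Finset.sum_map (Fintype.piFinset good' ×ˢ Finset.univ) ⟨_, hinj⟩ (fun c =>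
    ‖runSteps Ox Oxi steps (Pi.single (false, 0, 0, 0, 0) 1) c‖ ^ 2)).symm.trans_le ?_
  refine Finset.sum_le_sum_of_subset_of_nonneg ?_ fun _ _ _ => sq_nonneg _
  intro c hc
  simp only [Finset.mem_map, Finset.mem_product, Fintype.mem_piFinset, Finset.mem_univ, and_true,
    Function.Embedding.coeFn_mk] at hc
  obtain ⟨qm, hqm, rfl⟩ := hc
  refine hgoodset _ fun i => ?_
  have := hqm i
  simpa [good'] using this

end Algorithm

/-! ### Centroids as inner products -/

theorem sum_dite_lt_eq_sum {N m : ℕ} (hN : N ≤ m) {A : Type*} [AddCommMonoid A] (F : Fin N → A) :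
    ∑ y : Fin m, (if h : (y : ℕ) < N then F ⟨y, h⟩ else 0) = ∑ i, F i := by
  refine (Fintype.sum_of_injective (Fin.castLE hN) (Fin.castLE_injective hN) _ _ ?_ ?_).symm
  · intro y hy
    rw [dif_neg]
    exact fun h => hy ⟨⟨y, h⟩, rfl⟩
  · intro i
    simp

section Data

variable {N d n : ℕ} (X : Matrix (Fin N) (Fin d) ℝ)

theorem colNorm_sq (l : Fin d) : colNorm X l ^ 2 = ∑ i, X i l ^ 2 :=
  Real.sq_sqrt (Finset.sum_nonneg fun _ _ => sq_nonneg _)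

theorem colNorm_nonneg (l : Fin d) : 0 ≤ colNorm X l := Real.sqrt_nonneg _

/-- Cauchy–Schwarz. It justifies the output 0 when $\eta_2 \le \varepsilon_2$ and for zero columns.
-/
theorem abs_centroid_le_colNorm (S : Finset (Fin N)) (hS : S.Nonempty) (l : Fin d) :
    |centroid X S l| ≤ colNorm X l := by
  have hcard : (1 : ℝ) ≤ S.card := by exact_mod_cast hS.card_pos
  have h0 := colNorm_nonneg X l
  have h1 : (∑ i ∈ S, X i l) ^ 2 ≤ (S.card * colNorm X l) ^ 2 := by
    calc (∑ i ∈ S, X i l) ^ 2 ≤ S.card * ∑ i ∈ S, X i l ^ 2 := sq_sum_le_card_mul_sum_sq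
      _ ≤ S.card * colNorm X l ^ 2 := by
          rw [colNorm_sq]
          gcongr
          exact Finset.subset_univ S
      _ ≤ (S.card * colNorm X l) ^ 2 := by
          rw [mul_pow]
          nlinarith [mul_nonneg (mul_nonneg (sub_nonneg.mpr hcard) (zero_le_one.trans hcard))
            (sq_nonneg (colNorm X l))]
  have h2 := abs_le_of_sq_le_sq h1 (by positivity)
  rw [centroid, abs_div, Nat.abs_cast, div_le_iff₀ (by linarith), mul_comm]
  exact h2

theorem sum_norm_sq_featureState (hN : N ≤ 2 ^ n) (l : Fin d) (hl : colNorm X l ≠ 0) :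
    ∑ y, ‖featureState n X l y‖ ^ 2 = 1 := by
  have h : ∀ y : Fin (2 ^ n), ‖featureState n X l y‖ ^ 2
      = if h : (y : ℕ) < N then X ⟨y, h⟩ l ^ 2 / colNorm X l ^ 2 else 0 := by
    intro y
    unfold featureState
    split_ifs
    · rw [Complex.norm_real, Real.norm_eq_abs, sq_abs, div_pow]
    · simp
  simp only [h]
  rw [sum_dite_lt_eq_sum hN (fun i => X i l ^ 2 / colNorm X l ^ 2), ← Finset.sum_div, ← colNorm_sq]
  exact div_self (pow_ne_zero 2 hl)

theorem sum_norm_sq_characteristicState (hN : N ≤ 2 ^ n) (S : Finset (Fin N))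
    (hS : S.Nonempty) : ∑ y, ‖characteristicState n S y‖ ^ 2 = 1 := by
  have hcard : (0 : ℝ) < S.card := by exact_mod_cast hS.card_pos
  have h : ∀ y : Fin (2 ^ n), ‖characteristicState n S y‖ ^ 2
      = if h : (y : ℕ) < N then (if (⟨y, h⟩ : Fin N) ∈ S then 1 / (S.card : ℝ) else 0) else 0 := by
    intro y
    unfold characteristicState
    split_ifs
    · rw [Complex.norm_real, Real.norm_eq_abs, sq_abs, div_pow, one_pow, Real.sq_sqrt hcard.le]
    · simp
    · simp
  simp only [h]
  rw [sum_dite_lt_eq_sum hN (fun i => if i ∈ S then 1 / (S.card : ℝ) else 0), Finset.sum_ite_mem,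
    Finset.univ_inter, Finset.sum_const, nsmul_eq_mul]
  field_simp

theorem sum_star_characteristicState_mul_featureState (hN : N ≤ 2 ^ n) (S : Finset (Fin N))
    (l : Fin d) :
    ∑ y, star (characteristicState n S y) * featureState n X l y
      = ((Real.sqrt S.card / colNorm X l * centroid X S l : ℝ) : ℂ) := by
  have h : ∀ y : Fin (2 ^ n), star (characteristicState n S y) * featureState n X l y
      = if h : (y : ℕ) < N then (if (⟨y, h⟩ : Fin N) ∈ S then
        ((1 / Real.sqrt S.card * (X ⟨y, h⟩ l / colNorm X l) : ℝ) : ℂ) else 0) else 0 := by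
    intro y
    unfold characteristicState featureState
    split_ifs <;> simp
  simp only [h]
  rw [sum_dite_lt_eq_sum hN (fun i => if i ∈ S then
    ((1 / Real.sqrt S.card * (X i l / colNorm X l) : ℝ) : ℂ) else 0), Finset.sum_ite_mem,
    Finset.univ_inter, ← Complex.ofReal_sum, ← Finset.mul_sum, ← Finset.sum_div, centroid]
  congr 1
  rw [← Real.sqrt_div_self']
  ring

end Data

/-! ### The centroid algorithm -/

theorem mainTheorem7 (p K : ℝ) (hp : p < 1) :
    ∃ B : ℝ, 0 < B ∧
      ∀ (N d k n : ℕ) [NeZero d] [NeZero k], N ≤ 2 ^ n →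
      ∀ (T Txi ε₂ : ℝ), 0 ≤ T → 0 ≤ Txi → T ≤ K * Txi → 0 < ε₂ →
      -- the classical side information: column norms and cluster sizes
      ∀ (ν : Fin d → ℝ) (m : Fin k → ℕ), (∀ l, 0 ≤ ν l) →
      ∃ (a : ℕ) (A : CentroidAlgorithm d k n a),
        A.time T Txi ≤ B * (Txi * k * d * (⨆ l, ν l) / ε₂) ∧
        ∀ (X : Matrix (Fin N) (Fin d) ℝ) (cluster : Fin k → Finset (Fin N))
          (Ox : Matrix.unitaryGroup (Fin d × Fin (2 ^ n)) ℂ)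
          (Oxi : Matrix.unitaryGroup (Fin k × Fin (2 ^ n)) ℂ),
          (∀ l, colNorm X l = ν l) →
          (∀ j, (cluster j).Nonempty ∧ (cluster j).card = m j) →
          (∀ l, colNorm X l ≠ 0 → PreparesAt Ox l (featureState n X l)) →
          (∀ j, PreparesAt Oxi j (characteristicState n (cluster j))) →
          p ≤ A.outputProb Ox Oxi
            (fun cbar => ∀ j, ‖cbar j - centroid X (cluster j)‖ ≤ ε₂) := by
  classical
  have hmax : max p 0 < 1 := max_lt hp one_pos
  obtain ⟨κ, hκ, hκ1, hκp⟩ : ∃ κ : ℝ, 0 < κ ∧ κ < 1 ∧ p ≤ 1 - 3 * κ :=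
    ⟨(1 - max p 0) / 4, by linarith, by linarith [le_max_right p 0],
      by linarith [le_max_left p 0]⟩
  set c₀ : ℕ := ⌈80 / κ ^ 2⌉₊ with hc₀
  have hc₀pos : 0 < c₀ := Nat.ceil_pos.mpr (by positivity)
  have hc₀le : 80 ≤ κ ^ 2 * c₀ := by
    have := Nat.le_ceil (80 / κ ^ 2)
    rwa [div_le_iff₀ (by positivity), mul_comm] at this
  -- The budget is $L = c_0 n_0 kd$. The factor 6 combines $2L + |\iota| \le 3L$ with $n_0 \le
  -- 2\eta_2/\varepsilon_2$, and $|K| + 1$ bounds $T + T_\xi$ in units of $T_\xi$.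
  refine ⟨6 * c₀ * (|K| + 1), by positivity, ?_⟩
  intro N d k n _ _ hN T Txi ε hT hTxi hTK hε ν m hν
  set η := ⨆ l, ν l with hη
  have hη0 : 0 ≤ η := Real.iSup_nonneg hν
  have hνη : ∀ l, ν l ≤ η := fun l => le_ciSup (Set.finite_range ν).bddAbove l
  by_cases hcase : η ≤ ε
  -- No queries are made here: for small $\eta_2/\varepsilon_2$ the time bound leaves no room for
  -- even one round.
  · refine ⟨0, ⟨[], fun _ _ _ => 0⟩, ?_, ?_⟩
    · simp only [CentroidAlgorithm.time, List.map_nil, List.sum_nil]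
      positivity
    · intro X cluster Ox Oxi hX hcl _ _
      have hP : ∀ j, ‖(fun _ => 0 : Fin d → ℝ) - centroid X (cluster j)‖ ≤ ε := by
        intro j
        refine (pi_norm_le_iff_of_nonneg hε.le).mpr fun l => ?_
        rw [Pi.sub_apply, zero_sub, norm_neg, Real.norm_eq_abs]
        refine (abs_centroid_le_colNorm X _ (hcl j).1 l).trans ?_
        rw [hX l]
        exact (hνη l).trans hcase
      refine hp.le.trans ?_
      unfold CentroidAlgorithm.outputProb
      refine le_trans (le_of_eq ?_) (Finset.single_le_sum (fun b _ => ?_)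
        (Finset.mem_univ (false, 0, 0, 0, 0)))
      · rw [if_pos hP]
        simp [CentroidAlgorithm.finalState]
      · split_ifs <;> positivity
  · push Not at hcase
    have hratio : 1 ≤ η / ε := by rw [le_div_iff₀ hε]; linarith
    set n₀ : ℕ := ⌈η / ε⌉₊ with hn₀
    have hn₀1 : 1 ≤ n₀ := Nat.ceil_pos.mpr (by linarith)
    have hn₀le : η / ε ≤ n₀ := Nat.le_ceil _
    have hn₀lt : (n₀ : ℝ) ≤ 2 * (η / ε) := by
      have := Nat.ceil_lt_add_one (show 0 ≤ η / ε by linarith)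
      linarith
    have hn₀' : (1 : ℝ) ≤ n₀ := by exact_mod_cast hn₀1
    have hd : 1 ≤ d := Nat.one_le_iff_ne_zero.mpr (NeZero.ne d)
    have hk : 1 ≤ k := Nat.one_le_iff_ne_zero.mpr (NeZero.ne k)
    have hkd : 1 ≤ k * d := Nat.one_le_iff_ne_zero.mpr (Nat.mul_ne_zero (by omega) (by omega))
    have hcard : Fintype.card ({l : Fin d // ν l ≠ 0} × Fin k) ≤ k * d := by
      rw [Fintype.card_prod, Fintype.card_fin, mul_comm]
      have := Fintype.card_subtype_le (fun l : Fin d => ν l ≠ 0)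
      rw [Fintype.card_fin] at this
      exact Nat.mul_le_mul_left k this
    -- Only nonzero columns are estimated, since the feature oracle promises nothing on the others.
    obtain ⟨a, steps, est, htime, hprob⟩ := exists_inner_product_estimation
      (fun i : {l : Fin d // ν l ≠ 0} × Fin k => (i.1.1, i.2)) n hκ hκ1 n₀ (k * d)
      (c₀ * n₀ * (k * d)) hn₀1 hkd hcard (by
        push_cast
        have : 0 ≤ (n₀ : ℝ) * (k * d) := by positivity
        nlinarith [mul_le_mul_of_nonneg_right hc₀le this])
    refine ⟨a, ⟨steps, fun c j l => if h : ν l ≠ 0 then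
      ν l / Real.sqrt (m j) * est c (⟨l, h⟩, j) else 0⟩, ?_, ?_⟩
    · rw [CentroidAlgorithm.time, htime]
      have hcard' : (Fintype.card ({l : Fin d // ν l ≠ 0} × Fin k) : ℝ) ≤ c₀ * n₀ * (k * d) := by
        have h1 : 1 ≤ c₀ * n₀ := Nat.mul_pos hc₀pos hn₀1
        exact_mod_cast hcard.trans (Nat.le_mul_of_pos_left _ h1)
      have hTT : T + Txi ≤ (|K| + 1) * Txi := by
        have : K * Txi ≤ |K| * Txi := mul_le_mul_of_nonneg_right (le_abs_self K) hTxi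
        linarith
      calc _ ≤ (3 * (c₀ * n₀ * (k * d)) : ℝ) * ((|K| + 1) * Txi) := by
            push_cast
            refine mul_le_mul (by linarith) hTT (by positivity) (by positivity)
        _ ≤ (3 * (c₀ * (2 * (η / ε)) * (k * d)) : ℝ) * ((|K| + 1) * Txi) := by gcongr
        _ = _ := by ring
    · intro X cluster Ox Oxi hX hcl hOx hOxi
      have hm : ∀ j, (1 : ℝ) ≤ Real.sqrt (m j) := by
        intro j
        rw [Real.one_le_sqrt, ← (hcl j).2]
        exact_mod_cast (hcl j).1.card_pos
      have hmain := hprob Ox Oxi (fun i => featureState n X i.1.1)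
        (fun i => characteristicState n (cluster i.2))
        (fun i => Real.sqrt (cluster i.2).card / colNorm X i.1.1 * centroid X (cluster i.2) i.1.1)
        (fun i => hOx _ (by rw [hX]; exact i.1.2)) (fun i => hOxi _)
        (fun i => sum_norm_sq_featureState X hN _ (by rw [hX]; exact i.1.2))
        (fun i => sum_norm_sq_characteristicState hN _ (hcl i.2).1)
        (fun i => sum_star_characteristicState_mul_featureState X hN _ _)
        {c | ∀ j, ‖(fun l => if h : ν l ≠ 0 then ν l / Real.sqrt (m j) * est c (⟨l, h⟩, j) else 0)
          - centroid X (cluster j)‖ ≤ ε} (by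
          intro c hc
          rw [Finset.mem_filter]
          refine ⟨Finset.mem_univ _, fun j => (pi_norm_le_iff_of_nonneg hε.le).mpr fun l => ?_⟩
          rw [Pi.sub_apply, Real.norm_eq_abs]
          by_cases hl : ν l = 0
          · have := abs_centroid_le_colNorm X _ (hcl j).1 l
            rw [hX l, hl] at this
            rw [dif_neg (not_not.mpr hl), zero_sub, abs_neg]
            exact this.trans hε.le
          · have h1 := hc (⟨l, hl⟩, j)
            simp only [hX, (hcl j).2] at h1
            rw [dif_pos hl]
            have hs : (0 : ℝ) < Real.sqrt (m j) := one_pos.trans_le (hm j)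
            have e1 : ν l / Real.sqrt (m j) * est c (⟨l, hl⟩, j) - centroid X (cluster j) l
                = ν l / Real.sqrt (m j) * (est c (⟨l, hl⟩, j)
                  - Real.sqrt (m j) / ν l * centroid X (cluster j) l) := by
              field_simp
            have hνm : 0 ≤ ν l / Real.sqrt (m j) := div_nonneg (hν l) hs.le
            rw [e1, abs_mul, abs_of_nonneg hνm]
            -- The rescaling factor is at most $\eta_2$ because clusters have at least one element.
            calc _ ≤ η * (1 / n₀) := by
                  refine mul_le_mul ?_ h1 (abs_nonneg _) hη0
                  exact (div_le_self (hν l) (hm j)).trans (hνη l)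
              _ ≤ ε := by
                  rw [mul_one_div, div_le_iff₀ (by linarith)]
                  rw [div_le_iff₀ hε] at hn₀le
                  linarith)
      refine (hκp.trans hmain).trans (le_of_eq ?_)
      rw [Finset.sum_filter]
      unfold CentroidAlgorithm.outputProb
      congr! with c
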